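/- **Completeness of $\mathit{RK}_\mu^{\mathbb F}$.** Let $\mathrm{Prop}$ be a set of propositional letters and $\mathrm{Var}$ a set of variables. Formulas are $\varphi ::= p \mid \neg p \mid x \mid \varphi\wedge\varphi \mid \varphi\vee\varphi \mid \Box\varphi \mid \Diamond\varphi \mid \mu x.\varphi \mid \nu x.\varphi$. Write $x<_\varphi y$ if some subformula $\sigma y.\psi$ of $\varphi$ ($\sigma\in\{\mu,\nu\}$) has $x$ free; $\varphi$ is *well-named* if $<_\varphi$ is irreflexive and transitive. All formulas in sequents are required to be well-named. $V_\nu(\varphi)$ is the set of variables bound by $\nu$ in $\varphi$. $\varphi[\psi/x]$ replaces all instances of $x$ by $\psi$ and is only defined if $x$ is not bound in $\varphi$. *Preproofs.* A preproof of a derivation system is a finite tree labelled with sequents in which each node is the conclusion of a rule whose premises label its children, or is a leaf that is open, or is a leaf (a *bud* $t$) assigned an inner node $\beta(t)<t$ (its *companion*) carrying the same sequent. A proof has no open leaves and satisfies the soundness condition of the system. *The system $K_\mu$.* Sequents are finite sets $\Gamma$ of formulas. The rules (premises / conclusion; commas denote unions of sets) are: Ax: / $p,\neg p$; Wk: $\Gamma$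 / $\Gamma,\varphi$; $\vee$: $\Gamma,\varphi,\psi$ / $\Gamma,\varphi\vee\psi$; $\wedge$: $\Gamma,\varphi$ and $\Gamma,\psi$ / $\Gamma,\varphi\wedge\psi$; Mod: $\Gamma,\varphi$ / $\Diamond\Gamma,\Box\varphi$; $\sigma\in\{\mu,\nu\}$: $\Gamma,\varphi[\sigma x.\varphi/x]$ / $\Gamma,\sigma x.\varphi$. For a rule instance and a premise, a trace on $y$ may step from $(\varphi,y)$ to $(\varphi',y)$, where $\varphi$ is in the conclusion, $\varphi'$ in the premise and $y\in V_\nu(\varphi)\cap V_\nu(\varphi')$, if either $\varphi=\varphi'$ belongs to the context $\Gamma$ (rules other than Mod), with value $0$, or $\varphi$ is principal and $\varphi'$ results from it (in Mod all formulas are principal). In the latter case the value is $2$ if $\varphi=\mu x.\theta$ is unfolded and $x<_{\varphi}y$; it is $1$ if $\varphi=\nu y.\theta$ is unfolded; it is $0$ otherwise. From a bud to its companion traces continue unchanged with value $0$. A preproof is a proof if it has no open leaves and every infinite branch is, from some point on, followed by a trace that takes value $1$ infinitely often and never takes value $2$; equivalently, the path induced by the branch satisfies the trace condition of the trace category $\mathcal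 T_{\mathbb F}$ of the failure algebra $\mathbb F=(\{0,1,2\},\max,0,\alpha=1)$. Write $K_\mu\vdash\Gamma$ if some proof has root $\Gamma$. *The system $\mathit{RK}_\mu^{\mathbb F}$.* Fix a countably infinite set of letters. Sequents are $\Theta\mid\Gamma$ with $\Theta$ a finite sequence of distinct letters (the *control*) and $\Gamma$ a finite set of pairs $(\varphi,\sigma)$, where $\sigma$ maps each $x\in V_\nu(\varphi)$ to a subsequence of $\Theta$. $\varepsilon$ denotes the annotation with all values empty. $\Theta'$ denotes $\Theta$ without the letters that occur in no annotation of the premise concerned, and $\sigma'$ the restriction of $\sigma$ to the $\nu$-variables of the formula it annotates. The rules are (premises / conclusion): - Ax: / $\Theta\mid(p,\varepsilon),(\neg p,\varepsilon)$ - Wk: $\Theta'\mid\Gamma$ / $\Theta\mid\Gamma,(\varphi,\sigma)$ - $\vee$: $\Theta\mid\Gamma,(\varphi,\sigma'),(\psi,\sigma')$ / $\Theta\mid\Gamma,(\varphi\vee\psi,\sigma)$ - $\wedge$: $\Theta'\mid\Gamma,(\varphi,\sigma')$ and $\Theta'\mid\Gamma,(\psi,\sigma')$ / $\Theta\mid\Gamma,(\varphi\wedge\psi,\sigma)$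 - Mod: $\Theta\mid\Gamma,(\varphi,\sigma)$ / $\Theta\mid\Diamond\Gamma,(\Box\varphi,\sigma)$ - $\mu$: $\Theta'\mid\Gamma,(\varphi[\mu x.\varphi/x],\sigma\setminus x)$ / $\Theta\mid\Gamma,(\mu x.\varphi,\sigma)$, where $(\sigma\setminus x)(y)$ is empty if $x<_{\mu x.\varphi}y$ and is $\sigma(y)$ otherwise - $\nu$: $\Theta a\mid\Gamma,(\varphi[\nu x.\varphi/x],(\sigma[x\mapsto\sigma(x)a])')$ / $\Theta\mid\Gamma,(\nu x.\varphi,\sigma)$, for a letter $a\notin\Theta$ - $\mathrm{Reset}_a$: $\Theta'\mid\Gamma{\upharpoonright}a$ / $\Theta\mid\Gamma$, if $a\in\Theta$ is not the last letter of any sequence in an annotation in $\Gamma$; here ${\upharpoonright}a$ replaces every sequence $uav$ by $ua$ and leaves sequences without $a$ unchanged - Merge: $\Theta'\mid\Gamma,(\varphi,\mathrm{merge}_\Theta(\sigma,\tau))$ / $\Theta\mid\Gamma,(\varphi,\sigma),(\varphi,\tau)$, where $\mathrm{merge}_\Theta(\sigma,\tau)(x)=\min_{<_\Theta}(\sigma(x),\tau(x))$,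 and $u<_\Theta v$ iff $u$ contains the $\Theta$-least letter that occurs in exactly one of $u,v$. A preproof is a proof if it has no open leaves and for every bud $t$ there is a letter $a$ that occurs in all controls on the path from $\beta(t)$ to $t$, such that the part of the control preceding $a$ is the same along this path and $\mathrm{Reset}_a$ is applied on it. Write $\mathit{RK}_\mu^{\mathbb F}\vdash\Gamma$ if some proof has root $\varepsilon\mid\{(\varphi,\varepsilon)\mid\varphi\in\Gamma\}$ (with empty control). **Statement.** For every finite set $\Gamma$ of well-named formulas, if $K_\mu\vdash\Gamma$, then $\mathit{RK}_\mu^{\mathbb F}\vdash\Gamma$. -/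

import Mathlib

open CategoryTheory

set_option linter.checkUnivs false

noncomputable section

namespace CyclicMu

/-! ## Derivation systems, cyclic trees, preproofs -/

/-- A derivation system: every rule has a conclusion and a finite list of premises. -/
structure DerivationSystem where
  Seq : Type*
  Rule : Type*
  conc : Rule → Seq
  prem : Rule → List Seq

/-- A finite non-empty prefix-closed set of words over `ℕ`, with a partial map `back` from
leaves to inner nodes that are proper prefixes (buds and their companions). -/
structure CyclicTree where
  nodes : Set (List ℕ)
  finite : nodes.Finite
  root_mem : [] ∈ nodes
  prefix_closed : ∀ {s t : List ℕ}, t ∈ nodes → s <+: t → s ∈ nodes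
  back : List ℕ → Option (List ℕ)
  back_bud : ∀ {t c : List ℕ}, back t = some c → t ∈ nodes ∧ ∀ i, t ++ [i] ∉ nodes
  back_inner : ∀ {t c : List ℕ}, back t = some c → ∃ i, c ++ [i] ∈ nodes
  back_lt : ∀ {t c : List ℕ}, back t = some c → c <+: t ∧ c ≠ t

/-- `t` is a leaf of the tree. -/
def CyclicTree.IsLeaf (C : CyclicTree) (t : List ℕ) : Prop :=
  t ∈ C.nodes ∧ ∀ i, t ++ [i] ∉ C.nodes

/-- An infinite branch: it starts at the root, moves from inner nodes to children, and from
leaves (which then must be buds) to their companions. -/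
structure CyclicTree.IsBranch (C : CyclicTree) (π : ℕ → List ℕ) : Prop where
  zero : π 0 = []
  mem : ∀ n, π n ∈ C.nodes
  inner : ∀ n, ¬ C.IsLeaf (π n) → ∃ i, π (n + 1) = π n ++ [i]
  leaf : ∀ n, C.IsLeaf (π n) → C.back (π n) = some (π (n + 1))

/-- A preproof: a cyclic tree labelled by sequents and, partially, by rules. The children of a
node carrying a rule with `n` premises are `t0, …, t(n-1)`. The values of `label` outside
the tree are irrelevant. -/
structure Preproof (D : DerivationSystem) extends CyclicTree where
  label : List ℕ → D.Seq
  label_back : ∀ {t c : List ℕ}, back t = some c → label t = label c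
  rule : List ℕ → Option D.Rule
  rule_dom : ∀ {t : List ℕ} {r : D.Rule}, rule t = some r → t ∈ nodes ∧ back t = none
  rule_conc : ∀ {t : List ℕ} {r : D.Rule}, rule t = some r → label t = D.conc r
  rule_children : ∀ {t : List ℕ} {r : D.Rule}, rule t = some r →
    ∀ i, t ++ [i] ∈ nodes ↔ i < (D.prem r).length
  rule_prem : ∀ {t : List ℕ} {r : D.Rule}, rule t = some r →
    ∀ i (h : i < (D.prem r).length), label (t ++ [i]) = (D.prem r)[i]
  no_rule : ∀ {t : List ℕ}, t ∈ nodes → back t = none → rule t = none →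
    ∀ i, t ++ [i] ∉ nodes

/-- The preproof has no open leaves: every leaf is a bud or the conclusion of a rule. -/
def Preproof.NoAssumptions {D : DerivationSystem} (Q : Preproof D) : Prop :=
  ∀ t, Q.IsLeaf t → Q.back t ≠ none ∨ Q.rule t ≠ none

/-- A cyclic proof system: a derivation system with a set of assumption-free preproofs. -/
structure CyclicProofSystem extends DerivationSystem where
  proofs : Set (Preproof toDerivationSystem)
  closed : ∀ Q ∈ proofs, Q.NoAssumptions

/-- `Γ` is the endsequent of some proof. -/
def CyclicProofSystem.Proves (S : CyclicProofSystem) (Γ : S.Seq) : Prop :=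
  ∃ Q ∈ S.proofs, Q.label [] = Γ

/-! ## Activation algebras and their trace categories -/

/-- A finite join-semilattice with least element and an activation element different from it. -/
class ActivationAlgebra (A : Type*) [SemilatticeSup A] [OrderBot A] where
  finite : Finite A
  act : A
  bot_ne_act : (⊥ : A) ≠ act

/-- The failure algebra: `{0, 1, 2}` with `max`, activation element `1`. -/
instance : ActivationAlgebra (Fin 3) where
  finite := inferInstance
  act := 1
  bot_ne_act := by decide

/-- Objects of the trace category: finite sets (of elements of `U`). -/
structure TraceObj (U A : Type*) where
  carrier : Set U
  finite : carrier.Finite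

/-- Morphisms `X ⟶ Y` of the trace category: relations `R ⊆ X × A × Y`. -/
@[ext]
structure TraceHom {U A : Type*} (X Y : TraceObj U A) where
  rel : Set (U × A × U)
  dom_mem : ∀ t ∈ rel, t.1 ∈ X.carrier
  cod_mem : ∀ t ∈ rel, t.2.2 ∈ Y.carrier

instance {U A : Type*} [SemilatticeSup A] [OrderBot A] : Category (TraceObj U A) where
  Hom X Y := TraceHom X Y
  id X :=
    { rel := {t | t.1 ∈ X.carrier ∧ t.2.1 = ⊥ ∧ t.2.2 = t.1}
      dom_mem := fun _ h => h.1
      cod_mem := fun _ h => h.2.2 ▸ h.1 }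
  comp R S :=
    { rel := {t | ∃ y a b, (t.1, a, y) ∈ R.rel ∧ (y, b, t.2.2) ∈ S.rel ∧ a ⊔ b = t.2.1}
      dom_mem := fun _ ⟨_, _, _, h, _, _⟩ => (R.dom_mem _ h :)
      cod_mem := fun _ ⟨_, _, _, _, h, _⟩ => (S.cod_mem _ h :) }
  id_comp R := by
    apply TraceHom.ext
    ext ⟨x, c, z⟩
    constructor
    · rintro ⟨y, a, b, ⟨_, h1, h2⟩, h3, h4⟩
      simp only at h1 h2 h4
      subst h1 h2
      simpa [← h4] using h3
    · intro h
      exact ⟨x, ⊥, c, ⟨R.dom_mem (x, c, z) h, rfl, rfl⟩, h, by simp⟩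
  comp_id R := by
    apply TraceHom.ext
    ext ⟨x, c, z⟩
    constructor
    · rintro ⟨y, a, b, h3, ⟨_, h1, h2⟩, h4⟩
      simp only at h1 h2 h4
      subst h1 h2
      simpa [← h4] using h3
    · intro h
      exact ⟨z, c, ⊥, h, ⟨R.cod_mem (x, c, z) h, rfl, rfl⟩, by simp⟩
  assoc R S T := by
    apply TraceHom.ext
    ext ⟨x, c, z⟩
    constructor
    · rintro ⟨y, a, b, ⟨y', a', b', h1, h2, h3⟩, h4, h5⟩
      refine ⟨y', a', b' ⊔ b, h1, ⟨y, b', b, h2, h4, rfl⟩, ?_⟩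
      simp only at h3 h5
      rw [← h5, ← h3, sup_assoc]
    · rintro ⟨y, a, b, h1, ⟨y', a', b', h2, h3, h4⟩, h5⟩
      refine ⟨y', a ⊔ a', b', ⟨y, a, a', h1, h2, rfl⟩, h3, ?_⟩
      simp only at h4 h5
      rw [← h5, ← h4, sup_assoc]

/-- The trace condition of the trace category: some subpath `P ∘ S` carries a sequence all of
whose consecutive members are related with the activation element. -/
def TraceCondition {U A : Type*} [SemilatticeSup A] [OrderBot A] [ActivationAlgebra A]
    (P : ℕ ⥤ TraceObj U A) : Prop :=
  ∃ (S : ℕ → ℕ) (hS : StrictMono S) (s : ℕ → U),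
    (∀ i, s i ∈ (P.obj (S i)).carrier) ∧
    ∀ i, (s i, (ActivationAlgebra.act : A), s (i + 1)) ∈
      (P.map (homOfLE (hS.monotone (Nat.le_succ i)))).rel

/-- A trace interpretation of a derivation system in a trace category. -/
structure TraceInterpretation (D : DerivationSystem) (U A : Type*)
    [SemilatticeSup A] [OrderBot A] where
  obj : D.Seq → TraceObj U A
  mor : ∀ (r : D.Rule) (i : ℕ) (h : i < (D.prem r).length),
    obj (D.conc r) ⟶ obj (D.prem r)[i]

section Induced

variable {D : DerivationSystem} {U A : Type*} [SemilatticeSup A] [OrderBot A]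

/-- The morphism attached to the `n`-th step of a branch: the trace map of the rule and premise
when moving to a child, the identity when moving from a bud to its companion. -/
def TraceInterpretation.step (ι : TraceInterpretation D U A) (Q : Preproof D)
    {π : ℕ → List ℕ} (hπ : Q.IsBranch π) (n : ℕ) :
    ι.obj (Q.label (π n)) ⟶ ι.obj (Q.label (π (n + 1))) :=
  show TraceHom _ _ from
  { rel := {t | (∃ (r : D.Rule) (i : ℕ) (h : i < (D.prem r).length),
        Q.rule (π n) = some r ∧ π (n + 1) = π n ++ [i] ∧ t ∈ (ι.mor r i h).rel) ∨
      (Q.IsLeaf (π n) ∧ t ∈ TraceHom.rel (𝟙 (ι.obj (Q.label (π n)))))}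
    dom_mem := by
      rintro t (⟨r, i, h, h1, h2, h3⟩ | ⟨h1, h2⟩)
      · rw [Q.rule_conc h1]
        exact (ι.mor r i h).dom_mem t h3
      · exact TraceHom.dom_mem _ t h2
    cod_mem := by
      rintro t (⟨r, i, h, h1, h2, h3⟩ | ⟨h1, h2⟩)
      · rw [h2, Q.rule_prem h1 i h]
        exact (ι.mor r i h).cod_mem t h3
      · rw [← Q.label_back (hπ.leaf n h1)]
        exact TraceHom.cod_mem _ t h2 }

/-- The path through the trace category induced by a branch. -/
def TraceInterpretation.path (ι : TraceInterpretation D U A) (Q : Preproof D)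
    {π : ℕ → List ℕ} (hπ : Q.IsBranch π) : ℕ ⥤ TraceObj U A :=
  Functor.ofSequence (ι.step Q hπ)

/-- The cyclic proof system given by the global trace condition. -/
def TraceInterpretation.system [ActivationAlgebra A] (ι : TraceInterpretation D U A) :
    CyclicProofSystem where
  toDerivationSystem := D
  proofs := {Q | Q.NoAssumptions ∧
    ∀ (π : ℕ → List ℕ) (hπ : Q.IsBranch π), TraceCondition (ι.path Q hπ)}
  closed := fun _ h => h.1

end Induced

/-! ## Formulas of the modal `μ`-calculus -/

/-- Formulas over propositional letters `P` and variables `V`. -/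
inductive Form (P V : Type*) where
  | lit (p : P)
  | nlit (p : P)
  | var (x : V)
  | and (φ ψ : Form P V)
  | or (φ ψ : Form P V)
  | box (φ : Form P V)
  | dia (φ : Form P V)
  | mu (x : V) (φ : Form P V)
  | nu (x : V) (φ : Form P V)

namespace Form

variable {P V : Type*}

/-- Free variables. -/
def free : Form P V → Set V
  | lit _ => ∅
  | nlit _ => ∅
  | var x => {x}
  | and φ ψ => free φ ∪ free ψ
  | or φ ψ => free φ ∪ free ψ
  | box φ => free φ
  | dia φ => free φ
  | mu x φ => free φ \ {x}
  | nu x φ => free φ \ {x}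

/-- Variables bound by `ν` in the formula. -/
def nuVars : Form P V → Set V
  | lit _ => ∅
  | nlit _ => ∅
  | var _ => ∅
  | and φ ψ => nuVars φ ∪ nuVars ψ
  | or φ ψ => nuVars φ ∪ nuVars ψ
  | box φ => nuVars φ
  | dia φ => nuVars φ
  | mu _ φ => nuVars φ
  | nu x φ => insert x (nuVars φ)

theorem nuVars_finite (φ : Form P V) : φ.nuVars.Finite := by
  induction φ with
  | lit | nlit | var => exact Set.finite_empty
  | and _ _ h1 h2 | or _ _ h1 h2 => exact h1.union h2
  | box _ h | dia _ h | mu _ _ h => exact h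
  | nu x _ h => exact h.insert x

/-- The set of subformulas, including the formula itself. -/
def subformulas : Form P V → Set (Form P V)
  | lit p => {lit p}
  | nlit p => {nlit p}
  | var x => {var x}
  | and φ ψ => insert (and φ ψ) (subformulas φ ∪ subformulas ψ)
  | or φ ψ => insert (or φ ψ) (subformulas φ ∪ subformulas ψ)
  | box φ => insert (box φ) (subformulas φ)
  | dia φ => insert (dia φ) (subformulas φ)
  | mu x φ => insert (mu x φ) (subformulas φ)
  | nu x φ => insert (nu x φ) (subformulas φ)

/-- `x` is bound by some fixed-point quantifier in `φ`. -/
def Binds (φ : Form P V) (x : V) : Prop :=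
  ∃ ψ, mu x ψ ∈ φ.subformulas ∨ nu x ψ ∈ φ.subformulas

/-- `φ.Subsumes x y`: some subformula `σy.ψ` of `φ` has `x` free. -/
def Subsumes (φ : Form P V) (x y : V) : Prop :=
  ∃ ψ, (mu y ψ ∈ φ.subformulas ∧ x ∈ (mu y ψ).free) ∨
    (nu y ψ ∈ φ.subformulas ∧ x ∈ (nu y ψ).free)

/-- Subsumption is a strict preorder (irreflexive and transitive). -/
def WellNamed (φ : Form P V) : Prop :=
  (∀ x, ¬ φ.Subsumes x x) ∧
    ∀ x y z, φ.Subsumes x y → φ.Subsumes y z → φ.Subsumes x z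

open Classical in
/-- `φ.subst x θ` replaces all instances of the variable `x` in `φ` by `θ`. It is only used when
`x` is not bound in `φ`. -/
def subst (x : V) (θ : Form P V) : Form P V → Form P V
  | lit p => lit p
  | nlit p => nlit p
  | var y => if y = x then θ else var y
  | and φ ψ => and (subst x θ φ) (subst x θ ψ)
  | or φ ψ => or (subst x θ φ) (subst x θ ψ)
  | box φ => box (subst x θ φ)
  | dia φ => dia (subst x θ φ)
  | mu y φ => mu y (subst x θ φ)
  | nu y φ => nu y (subst x θ φ)

/-- The unfolding `φ[μx.φ / x]` of `μx.φ`. -/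
def unfoldMu (x : V) (φ : Form P V) : Form P V := subst x (mu x φ) φ

/-- The unfolding `φ[νx.φ / x]` of `νx.φ`. -/
def unfoldNu (x : V) (φ : Form P V) : Form P V := subst x (nu x φ) φ

end Form

/-! ## The cyclic system for the modal `μ`-calculus -/

/-- Sequents: finite sets of well-named formulas. -/
@[ext]
structure KSeq (P V : Type*) where
  forms : Set (Form P V)
  finite : forms.Finite
  wellNamed : ∀ φ ∈ forms, φ.WellNamed

open Form in
/-- Instances of the rules, with conclusion `c` and premises `p`, `q`, context `Γ`. -/
inductive KRule (P V : Type*) where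
  | ax (c : KSeq P V) (l : P) (hc : c.forms = {lit l, nlit l})
  | wk (c p : KSeq P V) (Γ : Set (Form P V)) (φ : Form P V)
      (hc : c.forms = insert φ Γ) (hp : p.forms = Γ)
  | or (c p : KSeq P V) (Γ : Set (Form P V)) (φ ψ : Form P V)
      (hc : c.forms = insert (Form.or φ ψ) Γ) (hp : p.forms = insert φ (insert ψ Γ))
  | and (c p q : KSeq P V) (Γ : Set (Form P V)) (φ ψ : Form P V)
      (hc : c.forms = insert (Form.and φ ψ) Γ)
      (hp : p.forms = insert φ Γ) (hq : q.forms = insert ψ Γ)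
  | mod (c p : KSeq P V) (Γ : Set (Form P V)) (φ : Form P V)
      (hc : c.forms = insert (box φ) (dia '' Γ)) (hp : p.forms = insert φ Γ)
  | mu (c p : KSeq P V) (Γ : Set (Form P V)) (x : V) (φ : Form P V) (hx : ¬ φ.Binds x)
      (hc : c.forms = insert (Form.mu x φ) Γ) (hp : p.forms = insert (unfoldMu x φ) Γ)
  | nu (c p : KSeq P V) (Γ : Set (Form P V)) (x : V) (φ : Form P V) (hx : ¬ φ.Binds x)
      (hc : c.forms = insert (Form.nu x φ) Γ) (hp : p.forms = insert (unfoldNu x φ) Γ)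

namespace KRule

variable {P V : Type*}

def conc : KRule P V → KSeq P V
  | ax c .. => c
  | wk c .. => c
  | or c .. => c
  | and c .. => c
  | mod c .. => c
  | mu c .. => c
  | nu c .. => c

def prem : KRule P V → List (KSeq P V)
  | ax .. => []
  | wk _ p .. => [p]
  | or _ p .. => [p]
  | and _ p q .. => [p, q]
  | mod _ p .. => [p]
  | mu _ p .. => [p]
  | nu _ p .. => [p]

/-- The formulas which are not altered by the rule. In `mod` every formula is altered. A formula
may be both altered and part of the context, sequents being sets. -/
def context : KRule P V → Set (Form P V)
  | ax .. => ∅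
  | wk _ _ Γ .. => Γ
  | or _ _ Γ .. => Γ
  | and _ _ _ Γ .. => Γ
  | mod .. => ∅
  | mu _ _ Γ .. => Γ
  | nu _ _ Γ .. => Γ

/-- `r.Results i χ χ'`: the formula `χ'` of premise `i` results from the principal formula `χ`. -/
def Results : KRule P V → ℕ → Form P V → Form P V → Prop
  | ax .., _, _, _ => False
  | wk .., _, _, _ => False
  | or _ _ _ φ ψ .., _, χ, χ' => χ = Form.or φ ψ ∧ (χ' = φ ∨ χ' = ψ)
  | and _ _ _ _ φ ψ .., i, χ, χ' =>
      χ = Form.and φ ψ ∧ ((i = 0 ∧ χ' = φ) ∨ (i = 1 ∧ χ' = ψ))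
  | mod _ _ Γ φ .., _, χ, χ' => (χ = Form.box φ ∧ χ' = φ) ∨ (χ = Form.dia χ' ∧ χ' ∈ Γ)
  | mu _ _ _ x φ .., _, χ, χ' => χ = Form.mu x φ ∧ χ' = Form.unfoldMu x φ
  | nu _ _ _ x φ .., _, χ, χ' => χ = Form.nu x φ ∧ χ' = Form.unfoldNu x φ

open Classical in
/-- The value attached to a step from a principal formula, for traces on the variable `y`:
failure if a `μ`-variable subsuming `y` is unfolded, progress if `y` itself is unfolded. -/
def value : KRule P V → V → Fin 3
  | mu _ _ _ x φ .., y => if (Form.mu x φ).Subsumes x y then 2 else 0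
  | nu _ _ _ x _ .., y => if y = x then 1 else 0
  | _, _ => 0

end KRule

/-- The derivation system of the modal `μ`-calculus. -/
abbrev KSystem (P V : Type*) : DerivationSystem where
  Seq := KSeq P V
  Rule := KRule P V
  conc := KRule.conc
  prem := KRule.prem

/-- The trace values of a sequent: its formulas paired with their `ν`-variables. -/
def traceValues {P V : Type*} (Γ : KSeq P V) : TraceObj (Form P V × V) (Fin 3) where
  carrier := {v | v.1 ∈ Γ.forms ∧ v.2 ∈ v.1.nuVars}
  finite := by
    refine (Γ.finite.biUnion (t := fun φ => (fun x => (φ, x)) '' φ.nuVars)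
      (fun φ _ => φ.nuVars_finite.image _)).subset ?_
    rintro ⟨φ, x⟩ ⟨h1, h2⟩
    exact Set.mem_biUnion h1 ⟨x, h2, rfl⟩

/-- The trace interpretation over the failure algebra. -/
def failureInterpretation (P V : Type*) :
    TraceInterpretation (KSystem P V) (Form P V × V) (Fin 3) where
  obj := traceValues
  mor r i h := show TraceHom (traceValues r.conc) (traceValues (r.prem[i]'h)) from
    { rel := {t | t.1 ∈ (traceValues r.conc).carrier ∧
          t.2.2 ∈ (traceValues (r.prem[i]'h)).carrier ∧ t.1.2 = t.2.2.2 ∧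
          ((t.1.1 ∈ r.context ∧ t.2.2.1 = t.1.1 ∧ t.2.1 = 0) ∨
            (r.Results i t.1.1 t.2.2.1 ∧ t.2.1 = r.value t.1.2))}
      dom_mem := fun _ ht => ht.1
      cod_mem := fun _ ht => ht.2.1 }

/-- The cyclic proof system `K_μ`. -/
def Kmu (P V : Type*) : CyclicProofSystem := (failureInterpretation P V).system

/-! ## The reset system -/

/-- A formula with an annotation. The annotation is a function from the `ν`-variables of the
formula to sequences of letters, extended by the empty sequence to all variables. -/
abbrev AForm (P V : Type*) := Form P V × (V → List ℕ)

/-- Sequents `Θ | Γ`: a control `Θ` of distinct letters and a finite set of annotated formulas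
whose annotations are subsequences of `Θ`. -/
@[ext]
structure RSeq (P V : Type*) where
  ctrl : List ℕ
  nodup : ctrl.Nodup
  forms : Set (AForm P V)
  finite : forms.Finite
  wellNamed : ∀ f ∈ forms, f.1.WellNamed
  support : ∀ f ∈ forms, ∀ x, x ∉ f.1.nuVars → f.2 x = []
  sublist : ∀ f ∈ forms, ∀ x, List.Sublist (f.2 x) ctrl

section Operations

variable {P V : Type*}

open Classical in
/-- The control with all letters removed that do not occur in an annotation in `Γ`. -/
def prune (Θ : List ℕ) (Γ : Set (AForm P V)) : List ℕ :=
  Θ.filter (fun a => ∃ f ∈ Γ, ∃ x, a ∈ f.2 x)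

open Classical in
/-- The annotation `σ` restricted to the `ν`-variables of `φ`. -/
def restrict (σ : V → List ℕ) (φ : Form P V) : V → List ℕ :=
  fun x => if x ∈ φ.nuVars then σ x else []

open Classical in
/-- The annotation of the unfolding of `μx.φ`: variables subsumed by `x` lose their sequence. -/
def eraseMu (σ : V → List ℕ) (x : V) (φ : Form P V) : V → List ℕ :=
  fun y => if (Form.mu x φ).Subsumes x y then [] else σ y

open Classical in
/-- The annotation of the unfolding of `νx.φ`: the letter `a` is appended to the sequence of `x`.
The restriction only matters if `x` is not free in `φ`. -/
def extendNu (σ : V → List ℕ) (x : V) (a : ℕ) (φ : Form P V) : V → List ℕ :=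
  restrict (Function.update σ x (σ x ++ [a])) (Form.unfoldNu x φ)

/-- `a` is covered: it is not the last letter of any sequence of an annotation in `Γ`. -/
def Covered (a : ℕ) (Γ : Set (AForm P V)) : Prop :=
  ∀ f ∈ Γ, ∀ x ∈ f.1.nuVars, a ∈ f.2 x → (f.2 x).getLast? ≠ some a

/-- `uav ↦ ua`, and `u ↦ u` if `a` does not occur in `u`. -/
def resetList (a : ℕ) (u : List ℕ) : List ℕ :=
  if a ∈ u then u.takeWhile (fun b => b ≠ a) ++ [a] else u

/-- The reset operation on annotated formulas. -/
def resetForm (a : ℕ) (f : AForm P V) : AForm P V :=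
  (f.1, fun x => resetList a (f.2 x))

/-- `u <_Θ v`: the sequence `u` contains the `Θ`-least letter occurring in exactly one of them. -/
def ctrlLT (Θ u v : List ℕ) : Prop :=
  ∃ c ∈ Θ, c ∈ u ∧ c ∉ v ∧ ∀ d ∈ Θ, Θ.idxOf d < Θ.idxOf c → (d ∈ u ↔ d ∈ v)

open Classical in
/-- The minimum of two subsequences of `Θ` with respect to `<_Θ`, for each variable. -/
def mergeAnn (Θ : List ℕ) (σ τ : V → List ℕ) : V → List ℕ :=
  fun x => if ctrlLT Θ (τ x) (σ x) then τ x else σ x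

end Operations

open Form in
/-- Instances of the rules of the reset system. -/
inductive RRule (P V : Type*) where
  | ax (c : RSeq P V) (l : P)
      (hc : c.forms = {(lit l, fun _ => []), (nlit l, fun _ => [])})
  | wk (c p : RSeq P V) (Γ : Set (AForm P V)) (φ : Form P V) (σ : V → List ℕ)
      (hc : c.forms = insert (φ, σ) Γ)
      (hp : p.forms = Γ) (hpc : p.ctrl = prune c.ctrl p.forms)
  | or (c p : RSeq P V) (Γ : Set (AForm P V)) (φ ψ : Form P V) (σ : V → List ℕ)
      (hc : c.forms = insert (Form.or φ ψ, σ) Γ)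
      (hp : p.forms = insert (φ, restrict σ φ) (insert (ψ, restrict σ ψ) Γ))
      (hpc : p.ctrl = c.ctrl)
  | and (c p q : RSeq P V) (Γ : Set (AForm P V)) (φ ψ : Form P V) (σ : V → List ℕ)
      (hc : c.forms = insert (Form.and φ ψ, σ) Γ)
      (hp : p.forms = insert (φ, restrict σ φ) Γ) (hpc : p.ctrl = prune c.ctrl p.forms)
      (hq : q.forms = insert (ψ, restrict σ ψ) Γ) (hqc : q.ctrl = prune c.ctrl q.forms)
  | mod (c p : RSeq P V) (Γ : Set (AForm P V)) (φ : Form P V) (σ : V → List ℕ)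
      (hc : c.forms = insert (box φ, σ) ((fun f : AForm P V => (dia f.1, f.2)) '' Γ))
      (hp : p.forms = insert (φ, σ) Γ) (hpc : p.ctrl = c.ctrl)
  | mu (c p : RSeq P V) (Γ : Set (AForm P V)) (x : V) (φ : Form P V) (σ : V → List ℕ)
      (hx : ¬ φ.Binds x) (hc : c.forms = insert (Form.mu x φ, σ) Γ)
      (hp : p.forms = insert (unfoldMu x φ, eraseMu σ x φ) Γ)
      (hpc : p.ctrl = prune c.ctrl p.forms)
  | nu (c p : RSeq P V) (Γ : Set (AForm P V)) (x : V) (φ : Form P V) (σ : V → List ℕ)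
      (a : ℕ) (ha : a ∉ c.ctrl)
      (hx : ¬ φ.Binds x) (hc : c.forms = insert (Form.nu x φ, σ) Γ)
      (hp : p.forms = insert (unfoldNu x φ, extendNu σ x a φ) Γ)
      (hpc : p.ctrl = c.ctrl ++ [a])
  | reset (c p : RSeq P V) (a : ℕ) (ha : a ∈ c.ctrl) (hcov : Covered a c.forms)
      (hp : p.forms = resetForm a '' c.forms) (hpc : p.ctrl = prune c.ctrl p.forms)
  | merge (c p : RSeq P V) (Γ : Set (AForm P V)) (φ : Form P V) (σ τ : V → List ℕ)
      (hc : c.forms = insert (φ, σ) (insert (φ, τ) Γ))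
      (hp : p.forms = insert (φ, mergeAnn c.ctrl σ τ) Γ)
      (hpc : p.ctrl = prune c.ctrl p.forms)

namespace RRule

variable {P V : Type*}

def conc : RRule P V → RSeq P V
  | ax c .. => c
  | wk c .. => c
  | or c .. => c
  | and c .. => c
  | mod c .. => c
  | mu c .. => c
  | nu c .. => c
  | reset c .. => c
  | merge c .. => c

def prem : RRule P V → List (RSeq P V)
  | ax .. => []
  | wk _ p .. => [p]
  | or _ p .. => [p]
  | and _ p q .. => [p, q]
  | mod _ p .. => [p]
  | mu _ p .. => [p]
  | nu _ p .. => [p]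
  | reset _ p .. => [p]
  | merge _ p .. => [p]

/-- The rule is an instance of `Reset_a`. -/
def IsReset (a : ℕ) : RRule P V → Prop
  | reset _ _ b .. => b = a
  | _ => False

end RRule

/-- The derivation system of the reset system. -/
abbrev RSystem (P V : Type*) : DerivationSystem where
  Seq := RSeq P V
  Rule := RRule P V
  conc := RRule.conc
  prem := RRule.prem

/-- The letter `a` is an invariant of the path from the companion `c` to the bud `t`: it occurs in
all controls along the path, the part of the control before `a` is the same along the path,
and `Reset_a` is applied on the path. -/
def IsInvariant {P V : Type*} (Q : Preproof (RSystem P V)) (c t : List ℕ) (a : ℕ) : Prop :=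
  (∀ s, c <+: s → s <+: t → a ∈ RSeq.ctrl (Q.label s)) ∧
  (∀ s, c <+: s → s <+: t →
    (RSeq.ctrl (Q.label s)).takeWhile (fun b => b ≠ a) =
      (RSeq.ctrl (Q.label t)).takeWhile (fun b => b ≠ a)) ∧
  ∃ s, c <+: s ∧ s <+: t ∧ ∃ r : RRule P V, Q.rule s = some r ∧ r.IsReset a

/-- The `𝔽`-reset modal `μ`-calculus as a cyclic proof system. -/
def RKmuF (P V : Type*) : CyclicProofSystem where
  toDerivationSystem := RSystem P V
  proofs := {Q | Q.NoAssumptions ∧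
    ∀ t c, Q.back t = some c → ∃ a, IsInvariant Q c t a}
  closed := fun _ h => h.1

/-- The sequent `ε | {(φ, ε) | φ ∈ Γ}`. -/
def KSeq.unannotated {P V : Type*} (Γ : KSeq P V) : RSeq P V where
  ctrl := []
  nodup := List.nodup_nil
  forms := (fun φ => (φ, fun _ => [])) '' Γ.forms
  finite := Γ.finite.image _
  wellNamed := by
    rintro _ ⟨φ, hφ, rfl⟩
    exact Γ.wellNamed φ hφ
  support := by
    rintro _ ⟨φ, hφ, rfl⟩ x _
    rfl
  sublist := by
    rintro _ ⟨φ, hφ, rfl⟩ x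
    exact List.Sublist.refl []

end CyclicMu

end

/-! Given a proof `Q` in `K_μ`, its rules are simulated on annotated sequents while a pointer moves
through `Q`, passing from buds to companions. Before each simulated rule the sequent is normalised:
duplicate annotations of a formula are merged and covered letters are reset. These silent steps
decrease a size, so an infinite play follows an infinite branch of `Q`.

In a normal sequent every control letter is the last letter of some annotation `σ(x)` of a formula
`φ`, and `(φ, x)` determines the letter. Hence the control is no longer than the number of trace
values of `Q` (`Normal.length_ctrl_le`). Fresh letters can then be taken from a fixed finite
alphabet, and only finitely many annotated sequents occur (`PlayState.finite_seqs`).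

The branch followed by an infinite play carries a trace on a fixed variable `y`, without failure and
with infinitely much progress. Along it the sequence annotating `y` never changes except by
appending a fresh letter (at progress), by becoming `<_Θ`-smaller (at a merge), or by a reset. The
combinatorial core `exists_stable_letter` shows that, the controls being bounded, some letter
eventually stays in the control, with a constant part before it, and is reset infinitely often.
Otherwise ever longer prefixes of the control would become permanent.

By pigeonhole a sequent recurs with a reset of that letter in between, which is a bud with an
invariant (`exists_good_repeat`). Stopping every play at its first such repeat leaves a finite tree
by Kőnig's lemma, and this tree is the required cyclic proof (`proves_of_strategy`). -/

namespace CyclicMu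

/-! ## Stabilization of control letters -/

/-- Admissible changes of a sequence of letters along one step of a derivation: no change,
a fresh letter is appended, the sequence gets smaller, or it is reset. -/
def WordStep (Θ : List ℕ) (Res : ℕ → Prop) (w w' : List ℕ) : Prop :=
  w' = w ∨ (∃ a, a ∉ Θ ∧ w' = w ++ [a]) ∨ ctrlLT Θ w' w ∨ ∃ b, Res b ∧ w' = resetList b w

theorem idxOf_lt_idxOf_of_mem_left {A B : List ℕ} {z d : ℕ} (hz : z ∈ A) (hd : d ∉ A) :
    (A ++ B).idxOf z < (A ++ B).idxOf d := by
  rw [List.idxOf_append_of_mem hz, List.idxOf_append_of_notMem hd]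
  have := List.idxOf_lt_length_of_mem hz
  omega

theorem takeWhile_ne_append_cons {u v : List ℕ} {b : ℕ} (h : b ∉ u) :
    (u ++ b :: v).takeWhile (fun x => x ≠ b) = u := by
  induction u with
  | nil => simp
  | cons c u ih =>
    simp only [List.mem_cons, not_or] at h
    have h1 : c ≠ b := fun e => h.1 e.symm
    simp only [List.cons_append]
    rw [List.takeWhile_cons_of_pos (by simpa using h1), ih h.2]

theorem mem_of_mem_resetList {b c : ℕ} {w : List ℕ} (h : c ∈ resetList b w) : c ∈ w := by
  unfold resetList at h
  split_ifs at h with hb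
  · rcases List.mem_append.1 h with h | h
    · exact List.takeWhile_subset _ h
    · rw [List.mem_singleton.1 h]; exact hb
  · exact h

theorem mem_resetList_self {b : ℕ} {w : List ℕ} : b ∈ resetList b w ↔ b ∈ w := by
  refine ⟨mem_of_mem_resetList, fun h => ?_⟩
  simp [resetList, h]

theorem resetList_sublist (b : ℕ) (w : List ℕ) : (resetList b w).Sublist w := by
  unfold resetList
  split_ifs with hb
  · obtain ⟨u, v, rfl, hu⟩ := List.eq_append_cons_of_mem hb
    rw [takeWhile_ne_append_cons hu]
    exact List.Sublist.append (List.Sublist.refl u) (by simp)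
  · exact List.Sublist.refl _

/-- The first letter of a sequence outside the prefix `P` is determined after a step by a letter
which is at most as far to the right. -/
theorem WordStep.exists_first {P X Y w w' : List ℕ} {c : ℕ} {Res : ℕ → Prop}
    (hnd : (P ++ (X ++ c :: Y)).Nodup) (hw : w.Sublist (P ++ (X ++ c :: Y)))
    (hX : ∀ d ∈ X, d ∉ w) (hc : c ∈ w)
    (hstep : WordStep (P ++ (X ++ c :: Y)) Res w w') (hres : ∀ b ∈ P, ¬ Res b)
    (hmem : ∀ d ∈ P, (d ∈ w' ↔ d ∈ w)) :
    ∃ X₁ e Y₁, X ++ c :: Y = X₁ ++ e :: Y₁ ∧ (∀ d ∈ X₁, d ∉ w') ∧ e ∈ w' ∧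
      ((X₁ = X ∧ e = c) ∨ X₁.length < X.length) := by
  rcases hstep with rfl | ⟨a, ha, rfl⟩ | ⟨d, hd, hd1, hd2, hd3⟩ | ⟨b, hb, rfl⟩
  · exact ⟨X, c, Y, rfl, hX, hc, Or.inl ⟨rfl, rfl⟩⟩
  · refine ⟨X, c, Y, rfl, ?_, by simp [hc], Or.inl ⟨rfl, rfl⟩⟩
    intro d hd h
    rcases List.mem_append.1 h with h | h
    · exact hX d hd h
    · rw [List.mem_singleton] at h
      subst h
      exact ha (by simp [hd])
  -- Here `d` is the least letter on which `w` and `w'` differ, and `w'` contains it. If `d` lies in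
  -- `X`, it becomes the new first letter; otherwise it lies beyond `c`, and nothing changes up to
  -- `c`.
  · have hdP : d ∉ P := fun h => hd2 ((hmem d h).1 hd1)
    by_cases hdX : d ∈ X
    · obtain ⟨X₁, X₂, rfl, hdX₁⟩ := List.eq_append_cons_of_mem hdX
      refine ⟨X₁, d, X₂ ++ c :: Y, by simp, ?_, hd1, Or.inr (by simp)⟩
      intro z hz hzw
      have hlt := idxOf_lt_idxOf_of_mem_left (A := P ++ X₁) (B := d :: X₂ ++ c :: Y)
        (z := z) (d := d) (by simp [hz]) (by simp [hdP, hdX₁])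
      have heq : P ++ X₁ ++ (d :: X₂ ++ c :: Y) = P ++ (X₁ ++ d :: X₂ ++ c :: Y) := by simp
      rw [heq] at hlt
      exact hX z (by simp [hz]) ((hd3 z (by simp [hz]) hlt).1 hzw)
    · have hdc : d ≠ c := fun e => hd2 (e ▸ hc)
      have key : ∀ z ∈ X ++ [c], (z ∈ w' ↔ z ∈ w) := by
        intro z hz
        have hlt := idxOf_lt_idxOf_of_mem_left (A := P ++ (X ++ [c])) (B := Y)
          (z := z) (d := d) (by simp only [List.mem_append] at hz ⊢; tauto) (by simp [hdP, hdX, hdc])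
        have heq : P ++ (X ++ [c]) ++ Y = P ++ (X ++ c :: Y) := by simp
        rw [heq] at hlt
        refine hd3 z ?_ hlt
        simp only [List.mem_append, List.mem_cons, List.not_mem_nil, or_false] at hz ⊢
        tauto
      refine ⟨X, c, Y, rfl, fun z hz h => hX z hz ((key z (by simp [hz])).1 h),
        (key c (by simp)).2 hc, Or.inl ⟨rfl, rfl⟩⟩
  -- A reset letter occurring in `w` is outside `P` and `X`, so it is `c` or comes after `c`. The
  -- cut made behind it therefore preserves `c`.
  · refine ⟨X, c, Y, rfl, fun d hd h => hX d hd (mem_of_mem_resetList h), ?_,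
      Or.inl ⟨rfl, rfl⟩⟩
    by_cases hbw : b ∈ w
    · by_cases hbc : b = c
      · subst hbc; exact mem_resetList_self.2 hc
      · have hbP : b ∉ P := fun h => hres b h hb
        have hbX : b ∉ X := fun h => hX b h hbw
        rw [← List.append_assoc] at hw hnd
        obtain ⟨l, m, rfl, hl, hm⟩ := List.sublist_append_iff.1 hw
        have hcl : c ∉ l := by
          intro h
          have := List.disjoint_of_nodup_append hnd (hl.subset h)
          simp at this
        have hbl : b ∉ l := by
          intro h
          have := hl.subset h
          simp [hbP, hbX] at this
        rcases List.sublist_cons_iff.1 hm with hm | ⟨m, rfl, hm⟩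
        · exfalso
          rcases List.mem_append.1 hc with h | h
          · exact hcl h
          · have := (List.nodup_append.1 hnd).2.1
            exact (List.nodup_cons.1 this).1 (hm.subset h)
        · have hbm : b ∈ m := by simpa [hbl, hbc] using hbw
          obtain ⟨m₁, m₂, rfl, hbm₁⟩ := List.eq_append_cons_of_mem hbm
          have : resetList b (l ++ c :: (m₁ ++ b :: m₂)) = l ++ c :: m₁ ++ [b] := by
            unfold resetList
            rw [if_pos hbw]
            have := takeWhile_ne_append_cons (u := l ++ c :: m₁) (v := m₂) (b := b)
              (by simp [hbl, hbc, hbm₁])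
            simp only [List.append_assoc, List.cons_append] at this ⊢
            rw [this]
            simp
          rw [this]
          simp
    · simpa [resetList, hbw] using hc

/-- Passing to the next control only deletes letters and appends `a`. The letter `e` survives
because it occurs in `w'`, it is not `a`, and what still precedes it beyond `P` comes from `X₁`. -/
theorem exists_first_of_sublist {P X₁ Y₁ R' w' : List ℕ} {e a : ℕ}
    (hnd : (P ++ (X₁ ++ e :: Y₁)).Nodup) (ha : a ∉ P ++ (X₁ ++ e :: Y₁))
    (hsub : (P ++ R').Sublist (P ++ (X₁ ++ e :: Y₁) ++ [a]))
    (hw' : w'.Sublist (P ++ R')) (hX₁ : ∀ d ∈ X₁, d ∉ w') (he : e ∈ w') :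
    ∃ X' Y', R' = X' ++ e :: Y' ∧ (∀ d ∈ X', d ∉ w') ∧ X'.Sublist X₁ := by
  rw [List.append_assoc, List.append_sublist_append_left, List.append_assoc,
    List.cons_append] at hsub
  obtain ⟨l, m, rfl, hl, hm⟩ := List.sublist_append_iff.1 hsub
  have hnd1 := List.nodup_append.1 hnd
  have hnd2 := List.nodup_append.1 hnd1.2.1
  have heP : e ∉ P := fun h => hnd1.2.2 e h e (by simp) rfl
  have heX : e ∉ X₁ := fun h => hnd2.2.2 e h e (by simp) rfl
  rcases List.sublist_cons_iff.1 hm with hm | ⟨m, rfl, hm⟩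
  · exfalso
    have h1 := hw'.subset he
    simp only [List.mem_append, heP, false_or] at h1
    rcases h1 with h1 | h1
    · exact heX (hl.subset h1)
    · have h2 := hm.subset h1
      simp only [List.mem_append, List.mem_singleton] at h2
      rcases h2 with h2 | rfl
      · exact (List.nodup_cons.1 hnd2.2.1).1 h2
      · exact ha (by simp)
  · exact ⟨l, m, rfl, fun d hd => hX₁ d (hl.subset hd), hl⟩

/-- If a sequence of letters is extended infinitely often along an infinite sequence of
controls of bounded length, then some letter is eventually stable and reset infinitely often. -/
theorem exists_stable_letter (Θ w : ℕ → List ℕ) (Res : ℕ → ℕ → Prop)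
    (hnd : ∀ n, (Θ n).Nodup) (hsub : ∀ n, (w n).Sublist (Θ n)) (B : ℕ)
    (hB : ∀ n, (Θ n).length ≤ B)
    (hΘ : ∀ n, ∃ a, a ∉ Θ n ∧ (Θ (n + 1)).Sublist (Θ n ++ [a]))
    (hw : ∀ n, WordStep (Θ n) (Res n) (w n) (w (n + 1)))
    (hinf : ∀ N, ∃ n ≥ N, ∃ a, a ∉ Θ n ∧ w (n + 1) = w n ++ [a]) :
    ∃ b N A, (∀ n ≥ N, b ∈ Θ n ∧ (Θ n).takeWhile (fun x => x ≠ b) = A) ∧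
      ∀ N, ∃ n ≥ N, Res n b := by
  by_contra! hneg
  -- If no letter is as claimed, arbitrarily long prefixes `P` become permanent, with constant
  -- membership in `w` and without resets. This contradicts the bound `B`.
  have key : ∀ k, ∃ P : List ℕ, k ≤ P.length ∧ ∃ N, (∀ n ≥ N, P <+: Θ n) ∧
      (∀ n ≥ N, ∀ d ∈ P, (d ∈ w (n + 1) ↔ d ∈ w n)) ∧ ∀ n ≥ N, ∀ b ∈ P, ¬ Res n b := by
    intro k
    induction k with
    | zero => exact ⟨[], by simp, 0, by simp, by simp, by simp⟩
    | succ k ih =>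
      obtain ⟨P, hPk, N, hP, hmem, hres⟩ := ih
      -- `c` is the first letter of `w n` in the control beyond `P`, and `X` is the gap between
      -- them. The length of `X` never increases, by `hstep`.
      let Sp : ℕ → List ℕ → ℕ → Prop := fun n X c =>
        ∃ Y, Θ n = P ++ (X ++ c :: Y) ∧ (∀ d ∈ X, d ∉ w n) ∧ c ∈ w n
      have hstep : ∀ n ≥ N, ∀ X c, Sp n X c →
          ∃ X' c', Sp (n + 1) X' c' ∧ ((X' = X ∧ c' = c) ∨ X'.length < X.length) := by
        rintro n hn X c ⟨Y, hY, hX, hc⟩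
        obtain ⟨a, ha, hs⟩ := hΘ n
        have h1 := hw n
        have h2 := hnd n
        have h3 := hsub n
        rw [hY] at h1 h2 h3 ha hs
        obtain ⟨X₁, e, Y₁, h4, h5, h6, h7⟩ :=
          h1.exists_first h2 h3 hX hc (hres n hn) (hmem n hn)
        obtain ⟨R', hR'⟩ := hP (n + 1) (by omega)
        have h8 := hsub (n + 1)
        rw [← hR'] at h8 hs
        rw [h4] at h2 ha hs
        obtain ⟨X', Y', rfl, h10, h11⟩ := exists_first_of_sublist h2 ha hs h8 h5 h6
        refine ⟨X', e, ⟨Y', hR'.symm, h10, h6⟩, ?_⟩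
        rcases h7 with ⟨rfl, rfl⟩ | h7
        · rcases h11.length_le.lt_or_eq with h | h
          · exact Or.inr h
          · exact Or.inl ⟨h11.eq_of_length h, rfl⟩
        · exact Or.inr (h11.length_le.trans_lt h7)
      have hex : ∃ m, ∃ n ≥ N, ∃ X c, Sp n X c ∧ X.length = m := by
        -- A letter appended after time `N` is fresh, hence outside `P`, so a first letter beyond
        -- `P` exists.
        obtain ⟨n, hn, a, ha, hwa⟩ := hinf N
        obtain ⟨R', hR'⟩ := hP (n + 1) (by omega)
        obtain ⟨R, hR⟩ := hP n hn
        have haP : a ∉ P := fun h => ha (by rw [← hR]; simp [h])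
        have haR : a ∈ R' := by
          have := (hsub (n + 1)).subset (show a ∈ w (n + 1) by simp [hwa])
          rw [← hR'] at this
          simpa [haP] using this
        have hsplit : ∀ R : List ℕ, a ∈ R → ∃ X c Y, R = X ++ c :: Y ∧
            (∀ d ∈ X, d ∉ w (n + 1)) ∧ c ∈ w (n + 1) := by
          intro R
          induction R with
          | nil => simp
          | cons r R ih =>
            intro h
            by_cases hr : r ∈ w (n + 1)
            · exact ⟨[], r, R, rfl, by simp, hr⟩
            · have har : a ≠ r := by
                rintro rfl
                exact hr (by simp [hwa])
              obtain ⟨X, c, Y, rfl, h1, h2⟩ := ih (by simpa [har] using h)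
              exact ⟨r :: X, c, Y, rfl, by simpa [hr] using h1, h2⟩
        obtain ⟨X, c, Y, rfl, h1, h2⟩ := hsplit R' haR
        exact ⟨_, n + 1, by omega, X, c, ⟨Y, hR'.symm, h1, h2⟩, rfl⟩
      classical
      -- Once the gap has minimal length it can no longer shrink, so from then on both `X` and `c`
      -- are constant and `P ++ X ++ [c]` is permanent.
      obtain ⟨n₁, hn₁, X, c, hSp, hlen⟩ := Nat.find_spec hex
      have hmin : ∀ n ≥ N, ∀ X' c', Sp n X' c' → X.length ≤ X'.length := by
        intro n hn X' c' h
        rw [hlen]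
        exact Nat.find_min' hex ⟨n, hn, X', c', h, rfl⟩
      have hall : ∀ n ≥ n₁, Sp n X c := by
        intro n hn
        induction n, hn using Nat.le_induction with
        | base => exact hSp
        | succ n hn ih =>
          obtain ⟨X', c', h1, ⟨rfl, rfl⟩ | h2⟩ := hstep n (by omega) X c ih
          · exact h1
          · have := hmin (n + 1) (by omega) X' c' h1
            omega
      have hpre : ∀ n ≥ n₁, P ++ X ++ [c] <+: Θ n := by
        intro n hn
        obtain ⟨Y, hY, -⟩ := hall n hn
        exact ⟨Y, by simp [hY]⟩
      -- Each letter of the permanent prefix has a constant part of the control before it, so the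
      -- negated goal allows only finitely many resets of it.
      have hnores : ∀ b ∈ {b | b ∈ P ++ X ++ [c]}, ∀ᶠ n in Filter.atTop, ¬ Res n b := by
        intro b hb
        obtain ⟨u, v, huv, hbu⟩ := List.eq_append_cons_of_mem hb
        obtain ⟨N', hN'⟩ := hneg b n₁ u (by
          intro n hn
          obtain ⟨Y, hY⟩ := hpre n hn
          rw [← hY, huv]
          refine ⟨by simp, ?_⟩
          rw [List.append_assoc, List.cons_append, takeWhile_ne_append_cons hbu])
        exact Filter.eventually_atTop.2 ⟨N', hN'⟩
      have hfin : {b | b ∈ P ++ X ++ [c]}.Finite := List.finite_toSet _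
      obtain ⟨N₂, hN₂⟩ := Filter.eventually_atTop.1 ((Filter.eventually_all_finite hfin).2 hnores)
      refine ⟨P ++ X ++ [c], by simp; omega, max n₁ N₂, fun n hn => hpre n (by omega), ?_,
        fun n hn b hb => hN₂ n (by omega) b hb⟩
      intro n hn d hd
      obtain ⟨Y, -, h1, h2⟩ := hall n (by omega)
      obtain ⟨Y', -, h1', h2'⟩ := hall (n + 1) (by omega)
      simp only [List.mem_append, List.mem_singleton] at hd
      rcases hd with (hd | hd) | rfl
      · exact hmem n (by omega) d hd
      · exact ⟨fun h => absurd h (h1' d hd), fun h => absurd h (h1 d hd)⟩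
      · exact ⟨fun _ => h2, fun _ => h2'⟩
  obtain ⟨P, hP, N, hN, -⟩ := key (B + 1)
  have := (hN N le_rfl).length_le
  have := hB N
  omega

/-! ## Infinite derivations with good repeats can be folded into cyclic proofs -/

section Strategy

variable {P V : Type*} {St : Type*}

/-- The state reached by following a word. -/
def run (next : St → ℕ → St) (s₀ : St) (w : List ℕ) : St := w.foldl next s₀

theorem run_append_singleton (next : St → ℕ → St) (s₀ : St) (w : List ℕ) (i : ℕ) :
    run next s₀ (w ++ [i]) = next (run next s₀ w) i := by
  simp [run]

/-- The word only uses existing premises. -/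
def ValidWord (rule : St → RRule P V) (next : St → ℕ → St) (s₀ : St) (w : List ℕ) : Prop :=
  ∀ u i, u ++ [i] <+: w → i < (rule (run next s₀ u)).prem.length

/-- The word `w` repeats the sequent of its prefix `c`, with an invariant in between. -/
def IsRepeat (label : St → RSeq P V) (rule : St → RRule P V) (next : St → ℕ → St) (s₀ : St)
    (w c : List ℕ) : Prop :=
  c <+: w ∧ c ≠ w ∧ label (run next s₀ w) = label (run next s₀ c) ∧
    ∃ a, (∀ s, c <+: s → s <+: w → a ∈ (label (run next s₀ s)).ctrl) ∧
      (∀ s, c <+: s → s <+: w → (label (run next s₀ s)).ctrl.takeWhile (fun b => b ≠ a) =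
        (label (run next s₀ w)).ctrl.takeWhile (fun b => b ≠ a)) ∧
      ∃ s, c <+: s ∧ s <+: w ∧ s ≠ w ∧ (rule (run next s₀ s)).IsReset a

/-- The words without a repeat strictly before their end. -/
def unfoldNodes (label : St → RSeq P V) (rule : St → RRule P V) (next : St → ℕ → St)
    (s₀ : St) : Set (List ℕ) :=
  {w | ValidWord rule next s₀ w ∧
    ∀ u, u <+: w → u ≠ w → ∀ c, ¬ IsRepeat label rule next s₀ u c}

/-- The first `n` letters of an infinite word. -/
def initWord (d : ℕ → ℕ) (n : ℕ) : List ℕ := (List.range n).map d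

theorem initWord_succ (d : ℕ → ℕ) (n : ℕ) : initWord d (n + 1) = initWord d n ++ [d n] := by
  simp [initWord, List.range_succ]

theorem length_initWord (d : ℕ → ℕ) (n : ℕ) : (initWord d n).length = n := by simp [initWord]

theorem initWord_prefix (d : ℕ → ℕ) {m n : ℕ} (h : m ≤ n) : initWord d m <+: initWord d n := by
  induction n, h using Nat.le_induction with
  | base => exact List.prefix_refl _
  | succ n _ ih => exact ih.trans (by rw [initWord_succ]; exact List.prefix_append _ _)

theorem eq_initWord_of_prefix {d : ℕ → ℕ} {n : ℕ} {s : List ℕ} (h : s <+: initWord d n) :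
    s = initWord d s.length ∧ s.length ≤ n := by
  have hl := h.length_le
  rw [length_initWord] at hl
  refine ⟨?_, hl⟩
  exact (List.prefix_of_prefix_length_le h (initWord_prefix d hl)
    (by rw [length_initWord])).eq_of_length (by rw [length_initWord])

/-- Kőnig's lemma for prefix-closed sets of words. -/
theorem finite_of_no_infinite_branch (T : Set (List ℕ))
    (hT : ∀ {s t : List ℕ}, t ∈ T → s <+: t → s ∈ T)
    (hfin : ∀ t, ∃ k, ∀ i, t ++ [i] ∈ T → i < k)
    (hbr : ∀ d : ℕ → ℕ, ∃ n, initWord d n ∉ T) : T.Finite := by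
  by_contra hinf
  -- A word is big if it has infinitely many extensions in `T`. Bigness passes to some child because
  -- there are only finitely many children.
  let Big : List ℕ → Prop := fun w => {t | t ∈ T ∧ w <+: t}.Infinite
  have hroot : Big [] := by
    have : {t | t ∈ T ∧ [] <+: t} = T := by ext; simp
    change Set.Infinite _
    rw [this]
    exact hinf
  have hstep : ∀ w, Big w → ∃ i, Big (w ++ [i]) := by
    intro w hw
    by_contra! hno
    obtain ⟨k, hk⟩ := hfin w
    refine hw (((Set.finite_singleton w).union (Set.Finite.biUnion (Set.finite_lt_nat k)
      (fun i _ => Set.not_infinite.1 (hno i)))).subset ?_)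
    rintro t ⟨ht, v, rfl⟩
    cases v with
    | nil => left; simp
    | cons i v =>
      right
      have h1 : w ++ [i] <+: w ++ i :: v := ⟨v, by simp⟩
      exact Set.mem_biUnion (hk i (hT ht h1)) ⟨ht, h1⟩
  choose! f hf using hstep
  let word : ℕ → List ℕ := fun n => Nat.rec [] (fun _ w => w ++ [f w]) n
  have hword : ∀ n, Big (word n) := by
    intro n
    induction n with
    | zero => exact hroot
    | succ n ih => exact hf _ ih
  have heq : ∀ n, initWord (fun n => f (word n)) n = word n := by
    intro n
    induction n with
    | zero => rfl
    | succ n ih => rw [initWord_succ, ih]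
  obtain ⟨n, hn⟩ := hbr (fun n => f (word n))
  rw [heq] at hn
  obtain ⟨t, ht, hpre⟩ := (hword n).nonempty
  exact hn (hT ht hpre)

variable (label : St → RSeq P V) (rule : St → RRule P V) (next : St → ℕ → St) (s₀ : St)

theorem unfoldNodes_prefix {s t : List ℕ} (ht : t ∈ unfoldNodes label rule next s₀)
    (h : s <+: t) : s ∈ unfoldNodes label rule next s₀ := by
  refine ⟨fun u i hu => ht.1 u i (hu.trans h), fun u hu hne c hc => ?_⟩
  refine ht.2 u (hu.trans h) (fun e => hne ?_) c hc
  subst e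
  exact hu.eq_of_length (le_antisymm hu.length_le h.length_le)

theorem append_mem_unfoldNodes_iff {t : List ℕ} {i : ℕ}
    (ht : t ∈ unfoldNodes label rule next s₀) :
    t ++ [i] ∈ unfoldNodes label rule next s₀ ↔
      i < (rule (run next s₀ t)).prem.length ∧ ∀ c, ¬ IsRepeat label rule next s₀ t c := by
  constructor
  · intro h
    exact ⟨h.1 t i (List.prefix_refl _), h.2 t (List.prefix_append _ _) (by simp)⟩
  · rintro ⟨h1, h2⟩
    refine ⟨fun u j hu => ?_, fun u hu hne c hc => ?_⟩
    · rcases List.prefix_concat_iff.1 hu with h | h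
      · have h3 := List.append_inj' h rfl
        obtain rfl : j = i := by simpa using h3.2
        rw [h3.1]
        exact h1
      · exact ht.1 u j h
    · rcases List.prefix_concat_iff.1 hu with h | h
      · exact hne h
      · by_cases hut : u = t
        · exact h2 c (hut ▸ hc)
        · exact ht.2 u h hut c hc

open Classical in
/-- The cyclic preproof obtained by stopping at the first repeats. -/
noncomputable def foldedPreproof (hconc : ∀ s, (rule s).conc = label s)
    (hnext : ∀ s i (h : i < (rule s).prem.length), label (next s i) = (rule s).prem[i])
    (hfin : (unfoldNodes label rule next s₀).Finite) : Preproof (RSystem P V) where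
  nodes := unfoldNodes label rule next s₀
  finite := hfin
  root_mem := by
    refine ⟨fun u i h => ?_, fun u hu hne => ?_⟩
    · exact absurd (List.prefix_nil.1 h) (by simp)
    · exact absurd (List.prefix_nil.1 hu) hne
  prefix_closed := unfoldNodes_prefix label rule next s₀
  -- Any prefix witnessing the repeat serves as companion. A repeat is a leaf, since a longer word
  -- would contain it strictly before its end.
  back t := if h : t ∈ unfoldNodes label rule next s₀ ∧
    ∃ c, IsRepeat label rule next s₀ t c then some h.2.choose else none
  back_bud {t c} h := by
    split_ifs at h with h1
    refine ⟨h1.1, fun i hi => ?_⟩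
    obtain ⟨c, hc⟩ := h1.2
    exact ((append_mem_unfoldNodes_iff label rule next s₀ h1.1).1 hi).2 c hc
  back_inner {t c} h := by
    split_ifs at h with h1
    have hc := h1.2.choose_spec
    rw [Option.some.inj h] at hc
    obtain ⟨v, hv⟩ := hc.1
    cases v with
    | nil => exact absurd (by simpa using hv) hc.2.1
    | cons i v =>
      exact ⟨i, unfoldNodes_prefix label rule next s₀ h1.1 ⟨v, by simpa using hv⟩⟩
  back_lt {t c} h := by
    split_ifs at h with h1
    have hc := h1.2.choose_spec
    rw [Option.some.inj h] at hc
    exact ⟨hc.1, hc.2.1⟩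
  label t := label (run next s₀ t)
  label_back {t c} h := by
    split_ifs at h with h1
    have hc := h1.2.choose_spec
    rw [Option.some.inj h] at hc
    exact hc.2.2.1
  rule t := if t ∈ unfoldNodes label rule next s₀ ∧
    ∀ c, ¬ IsRepeat label rule next s₀ t c then some (rule (run next s₀ t)) else none
  rule_dom {t r} h := by
    split_ifs at h with h1
    refine ⟨h1.1, ?_⟩
    rw [dif_neg]
    rintro ⟨-, c, hc⟩
    exact h1.2 c hc
  rule_conc {t r} h := by
    split_ifs at h with h1
    rw [← Option.some.inj h]
    exact (hconc _).symm
  rule_children {t r} h i := by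
    split_ifs at h with h1
    rw [append_mem_unfoldNodes_iff label rule next s₀ h1.1, ← Option.some.inj h]
    exact and_iff_left h1.2
  rule_prem {t r} h i hi := by
    split_ifs at h with h1
    obtain rfl := Option.some.inj h
    rw [run_append_singleton]
    exact hnext _ i hi
  no_rule {t} ht hb hr i hi := by
    have h1 := (append_mem_unfoldNodes_iff label rule next s₀ ht).1 hi
    rw [if_pos ⟨ht, h1.2⟩] at hr
    exact absurd hr (by simp)

/-- A strategy all of whose infinite plays contain a good repeat yields a cyclic proof. -/
theorem proves_of_strategy (hconc : ∀ s, (rule s).conc = label s)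
    (hnext : ∀ s i (h : i < (rule s).prem.length), label (next s i) = (rule s).prem[i])
    (hwin : ∀ (st : ℕ → St) (d : ℕ → ℕ), st 0 = s₀ →
      (∀ n, d n < (rule (st n)).prem.length ∧ st (n + 1) = next (st n) (d n)) →
      ∃ i j, i < j ∧ label (st j) = label (st i) ∧ ∃ a, (∀ n, i ≤ n → n ≤ j →
        a ∈ (label (st n)).ctrl ∧ (label (st n)).ctrl.takeWhile (fun b => b ≠ a) =
          (label (st j)).ctrl.takeWhile (fun b => b ≠ a)) ∧
        ∃ n, i ≤ n ∧ n < j ∧ (rule (st n)).IsReset a) :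
    (RKmuF P V).Proves (label s₀) := by
  have hfin : (unfoldNodes label rule next s₀).Finite := by
    refine finite_of_no_infinite_branch _ (unfoldNodes_prefix label rule next s₀) ?_ ?_
    · exact fun t => ⟨_, fun i hi => hi.1 t i (List.prefix_refl _)⟩
    · intro d
      by_contra! hd
      obtain ⟨i, j, hij, hlab, a, ha, n, hin, hnj, hres⟩ :=
        hwin (fun n => run next s₀ (initWord d n)) d rfl (by
          intro n
          have h := hd (n + 1)
          rw [initWord_succ] at h
          exact ⟨h.1 _ _ (List.prefix_refl _), by rw [initWord_succ, run_append_singleton]⟩)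
      have hne : ∀ m < j, initWord d m ≠ initWord d j := fun m hm e => by
        have := congrArg List.length e
        rw [length_initWord, length_initWord] at this
        omega
      have hrange : ∀ s, initWord d i <+: s → s <+: initWord d j →
          s = initWord d s.length ∧ i ≤ s.length ∧ s.length ≤ j := by
        intro s h1 h2
        have h3 := h1.length_le
        rw [length_initWord] at h3
        exact ⟨(eq_initWord_of_prefix h2).1, h3, (eq_initWord_of_prefix h2).2⟩
      -- The repeat ends at length `j`, so the prefix of length `j + 1` has it strictly before its
      -- end and cannot be a node.
      refine (hd (j + 1)).2 (initWord d j) (initWord_prefix d (by omega)) (fun e => ?_)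
        (initWord d i) ⟨initWord_prefix d hij.le, hne i hij, hlab, a, ?_, ?_,
          initWord d n, initWord_prefix d hin, initWord_prefix d hnj.le, hne n hnj, hres⟩
      · have := congrArg List.length e
        rw [length_initWord, length_initWord] at this
        omega
      · intro s h1 h2
        obtain ⟨h3, h4, h5⟩ := hrange s h1 h2
        rw [h3]
        exact (ha _ h4 h5).1
      · intro s h1 h2
        obtain ⟨h3, h4, h5⟩ := hrange s h1 h2
        rw [h3]
        exact (ha _ h4 h5).2
  refine ⟨foldedPreproof label rule next s₀ hconc hnext hfin, ⟨?_, ?_⟩, rfl⟩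
  · intro t ht
    by_cases h : ∃ c, IsRepeat label rule next s₀ t c
    · left
      simp only [foldedPreproof]
      rw [dif_pos ⟨ht.1, h⟩]
      simp
    · right
      simp only [foldedPreproof]
      rw [if_pos ⟨ht.1, not_exists.1 h⟩]
      simp
  · intro t c h
    simp only [foldedPreproof] at h
    split_ifs at h with h1
    have hc := h1.2.choose_spec
    rw [Option.some.inj h] at hc
    obtain ⟨-, -, -, a, h2, h3, s, h4, h5, h6, h7⟩ := hc
    refine ⟨a, h2, h3, s, h4, h5, rule (run next s₀ s), ?_, h7⟩
    simp only [foldedPreproof]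
    -- The bud itself carries no rule. The reset takes place at a proper prefix `s` of the bud,
    -- which is not a repeat and so does carry its rule.
    rw [if_pos]
    exact ⟨unfoldNodes_prefix label rule next s₀ h1.1 h5, h1.1.2 s h5 h6⟩

end Strategy

/-! ## Stepwise traces -/

section Traces

variable {U : Type*}

/-- A morphism of the path is the composite of its single steps, and values compose by `max`. Thus
no step exceeds the total value, and a total of `1` must be attained at some step. -/
theorem exists_trace_of_map (F : ℕ ⥤ TraceObj U (Fin 3)) {i j : ℕ} (h : i ≤ j) {u v : U}
    {a : Fin 3} (huv : (u, a, v) ∈ (F.map (homOfLE h)).rel) :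
    ∃ (f : ℕ → U) (b : ℕ → Fin 3), f i = u ∧ f j = v ∧
      (∀ k, i ≤ k → k < j → (f k, b k, f (k + 1)) ∈ (F.map (homOfLE k.le_succ)).rel ∧
        b k ≤ a) ∧ (a = 1 → ∃ k, i ≤ k ∧ k < j ∧ b k = 1) := by
  induction j, h using Nat.le_induction generalizing v a with
  | base =>
    have h1 : F.map (homOfLE (le_refl i)) = 𝟙 (F.obj i) := by
      rw [← F.map_id]
      rfl
    rw [h1] at huv
    obtain ⟨-, h2, h3⟩ := huv
    simp only at h2 h3
    subst h2 h3
    refine ⟨fun _ => v, fun _ => 0, rfl, rfl, fun k h4 h5 => by omega, fun h => ?_⟩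
    exact absurd h (by decide)
  | succ j hj ih =>
    have h1 : F.map (homOfLE (Nat.le_succ_of_le hj)) =
        F.map (homOfLE hj) ≫ F.map (homOfLE j.le_succ) := by
      rw [← F.map_comp]
      rfl
    rw [h1] at huv
    obtain ⟨y, a₁, a₂, h2, h3, h4⟩ := huv
    simp only at h2 h3 h4
    obtain ⟨f, b, h5, h6, h7, h8⟩ := ih h2
    refine ⟨fun k => if k ≤ j then f k else v, fun k => if k < j then b k else a₂, ?_, ?_, ?_, ?_⟩
    · beta_reduce
      rw [if_pos hj, h5]
    · beta_reduce
      rw [if_neg (by omega : ¬ j + 1 ≤ j)]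
    · intro k h9 h10
      beta_reduce
      rcases Nat.lt_succ_iff_lt_or_eq.1 h10 with h11 | rfl
      · obtain ⟨h12, h13⟩ := h7 k h9 h11
        rw [if_pos h11.le, if_pos h11, if_pos (by omega : k + 1 ≤ j)]
        exact ⟨h12, h13.trans (h4 ▸ le_sup_left)⟩
      · rw [if_pos le_rfl, if_neg (lt_irrefl k), if_neg (by omega : ¬ k + 1 ≤ k), h6]
        exact ⟨h3, h4 ▸ le_sup_right⟩
    · rintro rfl
      have h9 : a₁ = 1 ∨ a₂ = 1 := by
        revert h4
        clear * -
        revert a₁ a₂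
        decide
      rcases h9 with h9 | h9
      · obtain ⟨k, h10, h11, h12⟩ := h8 h9
        exact ⟨k, h10, by omega, by simp only [if_pos h11, h12]⟩
      · exact ⟨j, hj, by omega, by simp only [if_neg (lt_irrefl j), h9]⟩

/-- The trace condition over the failure algebra provides a trace without failure and with
infinitely much progress on a tail of the path. -/
theorem TraceCondition.exists_trace {F : ℕ ⥤ TraceObj U (Fin 3)} (h : TraceCondition F) :
    ∃ (N : ℕ) (u : ℕ → U) (b : ℕ → Fin 3),
      (∀ n ≥ N, (u n, b n, u (n + 1)) ∈ (F.map (homOfLE n.le_succ)).rel ∧ b n ≤ 1) ∧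
      ∀ M, ∃ n ≥ M, N ≤ n ∧ b n = 1 := by
  obtain ⟨S, hS, s, -, h⟩ := h
  choose f b hf₁ hf₂ hf₃ hf₄ using fun i => exists_trace_of_map F _ (h i)
  -- `idx n` is the block `[S i, S (i + 1))` containing `n`. Searching up to `n` suffices because `i
  -- ≤ S i`.
  let idx : ℕ → ℕ := fun n => Nat.findGreatest (fun i => S i ≤ n) n
  have hidx : ∀ i n, S i ≤ n → n < S (i + 1) → idx n = i := by
    intro i n h1 h2
    refine Nat.findGreatest_eq_iff.2 ⟨(hS.le_apply).trans h1, fun _ => h1, fun k hk _ hle => ?_⟩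
    have := hS.monotone (show i + 1 ≤ k from hk)
    omega
  have hex : ∀ n ≥ S 0, ∃ i, S i ≤ n ∧ n < S (i + 1) := by
    intro n hn
    have h1 : S (idx n) ≤ n := Nat.findGreatest_spec (P := fun i => S i ≤ n) (Nat.zero_le n) hn
    refine ⟨idx n, h1, ?_⟩
    by_contra! h2
    have h3 : idx n + 1 ≤ idx n :=
      Nat.le_findGreatest (P := fun i => S i ≤ n) ((hS.le_apply).trans h2) h2
    omega
  refine ⟨S 0, fun n => f (idx n) n, fun n => b (idx n) n, ?_, ?_⟩
  · intro n hn
    obtain ⟨i, h1, h2⟩ := hex n hn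
    obtain ⟨h3, h4⟩ := hf₃ i n h1 h2
    have h5 : f (idx (n + 1)) (n + 1) = f i (n + 1) := by
      rcases Nat.lt_or_ge (n + 1) (S (i + 1)) with h6 | h6
      · rw [hidx i (n + 1) (by omega) h6]
      -- At a block boundary the two local traces meet in `s (i + 1)`.
      · have h7 : n + 1 = S (i + 1) := by omega
        rw [hidx (i + 1) (n + 1) h7.ge (h7.trans_lt (hS (Nat.lt_succ_self _))), h7, hf₁, hf₂]
    simp only [h5, hidx i n h1 h2]
    exact ⟨h3, h4⟩
  · intro M
    obtain ⟨k, h1, h2, h3⟩ := hf₄ M rfl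
    refine ⟨k, (hS.le_apply).trans h1, (hS.monotone (Nat.zero_le M)).trans h1, ?_⟩
    simp only [hidx M k h1 h2, h3]

end Traces

/-- The trace relation of a move from `t` to `t'` in a preproof of `K_μ`. -/
def moveRel {P V : Type*} (Q : Preproof (KSystem P V)) (t t' : List ℕ) :
    Set ((Form P V × V) × Fin 3 × (Form P V × V)) :=
  {x | (∃ (r : KRule P V) (i : ℕ) (h : i < r.prem.length), Q.rule t = some r ∧
      t' = t ++ [i] ∧ x ∈ TraceHom.rel ((failureInterpretation P V).mor r i h)) ∨
    (Q.IsLeaf t ∧ x.1 ∈ (traceValues (Q.label t)).carrier ∧ x.2.1 = 0 ∧ x.2.2 = x.1)}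

/-- On every infinite branch of a proof in `K_μ` there is a trace without failure and with
infinitely much progress. -/
theorem exists_branch_trace {P V : Type*} {Q : Preproof (KSystem P V)}
    (hQ : Q ∈ (Kmu P V).proofs) {π : ℕ → List ℕ} (hπ : Q.IsBranch π) :
    ∃ (N : ℕ) (u : ℕ → Form P V × V) (b : ℕ → Fin 3),
      (∀ n ≥ N, (u n, b n, u (n + 1)) ∈ moveRel Q (π n) (π (n + 1)) ∧ b n ≤ 1) ∧
      ∀ M, ∃ n ≥ M, N ≤ n ∧ b n = 1 := by
  obtain ⟨N, u, b, h1, h2⟩ := (hQ.2 π hπ).exists_trace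
  refine ⟨N, u, b, fun n hn => ⟨?_, (h1 n hn).2⟩, h2⟩
  have h3 := (h1 n hn).1
  have h4 : ((failureInterpretation P V).path Q hπ).map (homOfLE n.le_succ) =
      (failureInterpretation P V).step Q hπ n := Functor.ofSequence_map_homOfLE_succ _ _
  rw [h4] at h3
  rcases h3 with ⟨r, i, h, h5, h6, h7⟩ | ⟨h5, h6⟩
  · exact Or.inl ⟨r, i, h, h5, h6, h7⟩
  · exact Or.inr ⟨h5, h6.1, h6.2.1, h6.2.2⟩

/-! ## Orders on sequences of letters -/

/-- A sublist of a list without repetitions is the filter of that list by membership. -/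
theorem sublist_eq_of_mem_iff {Θ u v : List ℕ} (hΘ : Θ.Nodup) (hu : u.Sublist Θ)
    (hv : v.Sublist Θ) (h : ∀ d ∈ Θ, (d ∈ u ↔ d ∈ v)) : u = v := by
  have key : ∀ w : List ℕ, w.Sublist Θ → w = Θ.filter (fun d => d ∈ w) := by
    intro w hw
    have h1 : w.Sublist (Θ.filter (fun d => d ∈ w)) := by
      have := hw.filter (fun d => decide (d ∈ w))
      rwa [List.filter_eq_self.2 (by simp)] at this
    refine h1.eq_of_length_le ((List.Nodup.subperm (hΘ.filter _) ?_).length_le)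
    intro d hd
    simpa using (List.mem_filter.1 hd).2
  rw [key u hu, key v hv]
  exact List.filter_congr (fun d hd => by simp [h d hd])

theorem ctrlLT_trichotomy {Θ u v : List ℕ} (hΘ : Θ.Nodup) (hu : u.Sublist Θ)
    (hv : v.Sublist Θ) : u = v ∨ ctrlLT Θ u v ∨ ctrlLT Θ v u := by
  classical
  by_cases h : ∀ d ∈ Θ, (d ∈ u ↔ d ∈ v)
  · exact Or.inl (sublist_eq_of_mem_iff hΘ hu hv h)
  · right
    have hex : ∃ k, ∃ d ∈ Θ, ¬ (d ∈ u ↔ d ∈ v) ∧ Θ.idxOf d = k := by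
      push Not at h
      obtain ⟨d, hd, h⟩ := h
      exact ⟨_, d, hd, by tauto, rfl⟩
    obtain ⟨d, hd, hne, hk⟩ := Nat.find_spec hex
    have hmin : ∀ e ∈ Θ, Θ.idxOf e < Θ.idxOf d → (e ∈ u ↔ e ∈ v) := by
      intro e he hlt
      by_contra hcon
      exact Nat.find_min hex (hk ▸ hlt) ⟨e, he, hcon, rfl⟩
    by_cases hdu : d ∈ u
    · exact Or.inl ⟨d, hd, hdu, fun h => hne (by tauto), hmin⟩
    · exact Or.inr ⟨d, hd, by tauto, hdu, fun e he hlt => (hmin e he hlt).symm⟩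

/-- One of the first `Θ.length + 1` numbers is missing from `Θ`. The explicit bound is what keeps
the alphabet of a play finite. -/
theorem exists_fresh_le (Θ : List ℕ) : ∃ a ≤ Θ.length, a ∉ Θ := by
  by_contra! h
  have h1 : List.range (Θ.length + 1) ⊆ Θ := fun a ha => h a (by
    have := List.mem_range.1 ha
    omega)
  have := (List.nodup_range.subperm h1).length_le
  simp at this

/-! ## Annotated sequents over a given sequent -/

namespace Form

variable {P V : Type*}

/-- Because unfolding loses no `ν`-variable, the annotation after a `μ`-unfolding needs no
restriction. -/
theorem nuVars_subset_nuVars_subst (x : V) (θ φ : Form P V) :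
    φ.nuVars ⊆ (subst x θ φ).nuVars := by
  induction φ with
  | lit | nlit => exact subset_rfl
  | var y => exact Set.empty_subset _
  | and _ _ h1 h2 | or _ _ h1 h2 => exact Set.union_subset_union h1 h2
  | box _ h | dia _ h | mu _ _ h => exact h
  | nu y _ h => exact Set.insert_subset_insert h

end Form

section Simulation

variable {P V : Type*}

/-- The annotation is supported on the `ν`-variables and consists of subsequences of `Θ`. -/
def GoodAnn (Θ : List ℕ) (f : AForm P V) : Prop :=
  ∀ x, (x ∉ f.1.nuVars → f.2 x = []) ∧ (f.2 x).Sublist Θ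

theorem RSeq.goodAnn (S : RSeq P V) {f : AForm P V} (hf : f ∈ S.forms) : GoodAnn S.ctrl f :=
  fun x => ⟨S.support f hf x, S.sublist f hf x⟩

theorem GoodAnn.restrict {Θ : List ℕ} {φ : Form P V} {σ : V → List ℕ}
    (h : GoodAnn Θ (φ, σ)) (ψ : Form P V) : GoodAnn Θ (ψ, restrict σ ψ) := by
  intro x
  by_cases hx : x ∈ ψ.nuVars
  · simpa [CyclicMu.restrict, hx] using (h x).2
  · simp [CyclicMu.restrict, hx]

theorem restrict_apply {σ : V → List ℕ} {φ : Form P V} {y : V} (h : y ∈ φ.nuVars) :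
    restrict σ φ y = σ y := by simp [restrict, h]

/-- An annotated sequent over a sequent of `K_μ`. -/
def annSeq (Θ : List ℕ) (F : Set (AForm P V)) (Γ : KSeq P V) (hnd : Θ.Nodup) (hfin : F.Finite)
    (hΓ : Prod.fst '' F = Γ.forms) (hF : ∀ f ∈ F, GoodAnn Θ f) : RSeq P V where
  ctrl := Θ
  nodup := hnd
  forms := F
  finite := hfin
  wellNamed := fun _ hf => Γ.wellNamed _ (hΓ ▸ Set.mem_image_of_mem _ hf)
  support := fun f hf x => (hF f hf x).1
  sublist := fun f hf x => (hF f hf x).2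

theorem goodAnn_prune {Θ : List ℕ} {F : Set (AForm P V)} (hF : ∀ f ∈ F, GoodAnn Θ f) :
    ∀ f ∈ F, GoodAnn (prune Θ F) f := by
  classical
  intro f hf x
  refine ⟨(hF f hf x).1, ?_⟩
  have h := (hF f hf x).2.filter (fun a => decide (∃ f ∈ F, ∃ x, a ∈ f.2 x))
  rw [List.filter_eq_self.2] at h
  · convert h using 1
    unfold prune
    congr 1
  · intro a ha
    exact decide_eq_true ⟨f, hf, x, ha⟩

theorem prune_sublist (Θ : List ℕ) (F : Set (AForm P V)) : (prune Θ F).Sublist Θ :=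
  List.filter_sublist

/-! ### Normal sequents and the termination of merging and resetting -/

/-- Every formula carries at most one annotation. -/
def MergeFree (S : RSeq P V) : Prop :=
  ∀ φ σ τ, (φ, σ) ∈ S.forms → (φ, τ) ∈ S.forms → σ = τ

/-- Every formula carries at most one annotation and no letter is covered. -/
def Normal (S : RSeq P V) : Prop := MergeFree S ∧ ∀ a ∈ S.ctrl, ¬ Covered a S.forms

/-- The size of an annotated formula. -/
noncomputable def weight (f : AForm P V) : ℕ := 1 + ∑ x ∈ f.1.nuVars_finite.toFinset, (f.2 x).length

/-- The size of an annotated sequent. -/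
noncomputable def RSeq.size (S : RSeq P V) : ℕ := ∑ f ∈ S.finite.toFinset, weight f + S.ctrl.length

/-- A step which does not alter the formulas of the sequent and reduces its size. -/
structure SilentStep (S S' : RSeq P V) (r : RRule P V) : Prop where
  conc : r.conc = S
  prem : r.prem = [S']
  forms : Prod.fst '' S'.forms = Prod.fst '' S.forms
  ctrl : S'.ctrl.Sublist S.ctrl
  word : ∀ g ∈ S.forms, ∃ g' ∈ S'.forms, g'.1 = g.1 ∧
    ∀ y, WordStep S.ctrl (fun b => r.IsReset b) (g.2 y) (g'.2 y)
  size : S'.size < S.size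

/-- For each variable the merged sequence is the smaller of the two, so either annotation sees no
change or a `<_Θ`-decrease. The size drops because two formulas are replaced by one. -/
theorem exists_merge_step {S : RSeq P V} {Γ : KSeq P V} (hΓ : Prod.fst '' S.forms = Γ.forms)
    (h : ¬ MergeFree S) : ∃ r S', SilentStep S S' r := by
  classical
  simp only [MergeFree, not_forall] at h
  obtain ⟨φ, σ, τ, hσ, hτ, hne⟩ := h
  -- Both annotated formulas are removed from the context. If one of them stayed, the premise might
  -- coincide with the conclusion.
  set Γ₀ : Set (AForm P V) := S.forms \ {(φ, σ), (φ, τ)} with hΓ₀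
  set m : AForm P V := (φ, mergeAnn S.ctrl σ τ) with hm
  have hforms : S.forms = insert (φ, σ) (insert (φ, τ) Γ₀) := by
    ext f
    simp only [hΓ₀, Set.mem_insert_iff, Set.mem_sdiff, Set.mem_singleton_iff]
    constructor
    · intro hf
      by_cases h1 : f = (φ, σ)
      · exact Or.inl h1
      · by_cases h2 : f = (φ, τ)
        · exact Or.inr (Or.inl h2)
        · exact Or.inr (Or.inr ⟨hf, by tauto⟩)
    · rintro (rfl | rfl | hf)
      · exact hσ
      · exact hτ
      · exact hf.1
  have himg : Prod.fst '' (insert m Γ₀) = Prod.fst '' S.forms := by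
    rw [hforms, Set.image_insert_eq, Set.image_insert_eq, Set.image_insert_eq]
    simp [hm]
  have hfin : (insert m Γ₀).Finite := (S.finite.subset Set.sdiff_subset).insert m
  have hmx : ∀ x, mergeAnn S.ctrl σ τ x = σ x ∨ mergeAnn S.ctrl σ τ x = τ x := by
    intro x
    unfold mergeAnn
    split_ifs
    · exact Or.inr rfl
    · exact Or.inl rfl
  have hgood : ∀ f ∈ insert m Γ₀, GoodAnn S.ctrl f := by
    rintro f (rfl | hf)
    · intro x
      have h1 := S.goodAnn hσ x
      have h2 := S.goodAnn hτ x
      rcases hmx x with h | h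
      · simpa only [hm, h] using h1
      · simpa only [hm, h] using h2
    · exact S.goodAnn hf.1
  let S' := annSeq (prune S.ctrl (insert m Γ₀)) (insert m Γ₀) Γ
    ((prune_sublist _ _).nodup S.nodup) hfin (himg.trans hΓ) (goodAnn_prune hgood)
  refine ⟨RRule.merge S S' Γ₀ φ σ τ hforms rfl rfl, S', rfl, rfl, himg, prune_sublist _ _, ?_, ?_⟩
  · intro g hg
    by_cases h1 : g = (φ, σ)
    · subst h1
      refine ⟨m, Set.mem_insert _ _, rfl, fun y => ?_⟩
      by_cases h2 : ctrlLT S.ctrl (τ y) (σ y)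
      · refine Or.inr (Or.inr (Or.inl ?_))
        simp [hm, mergeAnn, h2]
      · left
        simp [hm, mergeAnn, h2]
    · by_cases h1' : g = (φ, τ)
      · subst h1'
        refine ⟨m, Set.mem_insert _ _, rfl, fun y => ?_⟩
        by_cases h2 : ctrlLT S.ctrl (τ y) (σ y)
        · left
          simp [hm, mergeAnn, h2]
        · rcases ctrlLT_trichotomy S.nodup (S.goodAnn hσ y).2 (S.goodAnn hτ y).2 with h3 | h3 | h3
          · left
            simp only [hm, mergeAnn, h2, if_false]
            exact h3
          · refine Or.inr (Or.inr (Or.inl ?_))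
            simpa [hm, mergeAnn, h2] using h3
          · exact absurd h3 h2
      · exact ⟨g, Set.mem_insert_of_mem _ ⟨hg, by simp [h1, h1']⟩, rfl, fun y => Or.inl rfl⟩
  · have h0 : (S.finite.subset (Set.sdiff_subset (t := {(φ, σ), (φ, τ)}))).toFinset =
        (S.finite.toFinset.erase (φ, σ)).erase (φ, τ) := by
      ext f
      simp only [Set.Finite.mem_toFinset, Finset.mem_erase, Set.mem_sdiff, Set.mem_insert_iff,
        Set.mem_singleton_iff, not_or]
      tauto
    have h1 : ∑ f ∈ S'.finite.toFinset, weight f ≤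
        weight m + ∑ f ∈ (S.finite.toFinset.erase (φ, σ)).erase (φ, τ), weight f := by
      have h2 : S'.finite.toFinset ⊆ insert m ((S.finite.toFinset.erase (φ, σ)).erase (φ, τ)) := by
        rw [← h0]
        intro f hf
        simp only [Set.Finite.mem_toFinset, Finset.mem_insert] at hf ⊢
        exact hf
      refine (Finset.sum_le_sum_of_subset h2).trans ?_
      -- The merged formula may already be present as a third annotation of `φ`.
      by_cases h3 : m ∈ (S.finite.toFinset.erase (φ, σ)).erase (φ, τ)
      · rw [Finset.insert_eq_of_mem h3]
        omega
      · rw [Finset.sum_insert h3]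
    have hne' : ((φ, τ) : AForm P V) ≠ (φ, σ) := fun e => hne (congrArg Prod.snd e).symm
    have h4 := Finset.add_sum_erase S.finite.toFinset weight (S.finite.mem_toFinset.2 hσ)
    have h5 := Finset.add_sum_erase (S.finite.toFinset.erase (φ, σ)) weight
      (Finset.mem_erase.2 ⟨hne', S.finite.mem_toFinset.2 hτ⟩)
    -- Strictness comes from the summand `1` in `weight`, also when all sequences are empty.
    have h6 : weight m < weight ((φ, σ) : AForm P V) + weight ((φ, τ) : AForm P V) := by
      have : ∑ x ∈ φ.nuVars_finite.toFinset, (mergeAnn S.ctrl σ τ x).length ≤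
          ∑ x ∈ φ.nuVars_finite.toFinset, (σ x).length +
            ∑ x ∈ φ.nuVars_finite.toFinset, (τ x).length := by
        rw [← Finset.sum_add_distrib]
        refine Finset.sum_le_sum (fun x _ => ?_)
        rcases hmx x with h | h <;> rw [h] <;> omega
      simp only [weight, hm]
      omega
    have h7 := (prune_sublist S.ctrl (insert m Γ₀)).length_le
    have h8 : S'.ctrl = prune S.ctrl (insert m Γ₀) := rfl
    unfold RSeq.size
    rw [h8]
    omega

theorem resetList_getLast_lt {a : ℕ} {u : List ℕ} (ha : a ∈ u) (h : u.getLast? ≠ some a) :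
    (resetList a u).length < u.length := by
  rcases (resetList_sublist a u).length_le.lt_or_eq with h1 | h1
  · exact h1
  · exfalso
    apply h
    rw [← (resetList_sublist a u).eq_of_length h1]
    simp [resetList, ha]

/-- If the covered letter occurs in some sequence, it is not last there and the reset shortens that
sequence. If it occurs nowhere, pruning removes it from the control; this is why the size counts the
control. -/
theorem exists_reset_step {S : RSeq P V} {Γ : KSeq P V} (hΓ : Prod.fst '' S.forms = Γ.forms)
    {a : ℕ} (ha : a ∈ S.ctrl) (hcov : Covered a S.forms) : ∃ r S', SilentStep S S' r := by
  classical
  have himg : Prod.fst '' (resetForm a '' S.forms) = Prod.fst '' S.forms := by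
    rw [Set.image_image]
    rfl
  have hgood : ∀ f ∈ resetForm a '' S.forms, GoodAnn S.ctrl f := by
    rintro _ ⟨f, hf, rfl⟩ x
    refine ⟨fun hx => ?_, (resetList_sublist a _).trans (S.goodAnn hf x).2⟩
    have := (S.goodAnn hf x).1 hx
    simp [resetForm, this, resetList]
  let S' := annSeq (prune S.ctrl (resetForm a '' S.forms)) (resetForm a '' S.forms) Γ
    ((prune_sublist _ _).nodup S.nodup) (S.finite.image _) (himg.trans hΓ) (goodAnn_prune hgood)
  refine ⟨RRule.reset S S' a ha hcov rfl rfl, S', rfl, rfl, himg, prune_sublist _ _, ?_, ?_⟩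
  · intro g hg
    exact ⟨resetForm a g, Set.mem_image_of_mem _ hg, rfl,
      fun y => Or.inr (Or.inr (Or.inr ⟨a, rfl, rfl⟩))⟩
  · have h1 : ∑ f ∈ S'.finite.toFinset, weight f ≤
        ∑ f ∈ S.finite.toFinset, weight (resetForm a f) := by
      have h2 : S'.finite.toFinset = S.finite.toFinset.image (resetForm a) := by
        ext f
        simp only [Set.Finite.mem_toFinset, Finset.mem_image]
        rfl
      rw [h2]
      exact Finset.sum_image_le_of_nonneg (fun _ _ => Nat.zero_le _)
    have hle : ∀ (f : AForm P V) (x : V), ((resetForm a f).2 x).length ≤ (f.2 x).length :=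
      fun f x => (resetList_sublist a _).length_le
    have hwle : ∀ f : AForm P V, weight (resetForm a f) ≤ weight f :=
      fun f => Nat.add_le_add_left (Finset.sum_le_sum fun x _ => hle f x) 1
    have h7 := (prune_sublist S.ctrl (resetForm a '' S.forms)).length_le
    have h8 : S'.ctrl = prune S.ctrl (resetForm a '' S.forms) := rfl
    unfold RSeq.size
    rw [h8]
    by_cases hocc : ∃ f ∈ S.forms, ∃ x, a ∈ f.2 x
    · obtain ⟨f, hf, x, hx⟩ := hocc
      have hxv : x ∈ f.1.nuVars := by
        by_contra h
        rw [S.support f hf x h] at hx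
        simp at hx
      have h9 : ∑ f ∈ S.finite.toFinset, weight (resetForm a f) <
          ∑ f ∈ S.finite.toFinset, weight f := by
        refine Finset.sum_lt_sum (fun f _ => hwle f) ⟨f, S.finite.mem_toFinset.2 hf, ?_⟩
        exact Nat.add_lt_add_left (Finset.sum_lt_sum (fun x _ => hle f x)
          ⟨x, f.1.nuVars_finite.mem_toFinset.2 hxv, resetList_getLast_lt hx (hcov f hf x hxv hx)⟩) 1
      omega
    · have h9 : ∑ f ∈ S.finite.toFinset, weight (resetForm a f) ≤
          ∑ f ∈ S.finite.toFinset, weight f := Finset.sum_le_sum (fun f _ => hwle f)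
      have h10 : (prune S.ctrl (resetForm a '' S.forms)).length < S.ctrl.length := by
        refine lt_of_le_of_ne h7 (fun e => hocc ?_)
        rw [← (prune_sublist S.ctrl (resetForm a '' S.forms)).eq_of_length e] at ha
        have := (List.mem_filter.1 ha).2
        obtain ⟨_, ⟨f, hf, rfl⟩, x, hx⟩ := of_decide_eq_true this
        exact ⟨f, hf, x, mem_of_mem_resetList hx⟩
      omega

/-! ## Simulation of the rules -/

/-- The annotated formulas of a sequent whose formulas belong to `Γ`. -/
def lift (S : RSeq P V) (Γ : Set (Form P V)) : Set (AForm P V) := {f ∈ S.forms | f.1 ∈ Γ}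

theorem image_lift {S : RSeq P V} {Γ : Set (Form P V)} (h : Γ ⊆ Prod.fst '' S.forms) :
    Prod.fst '' lift S Γ = Γ := by
  ext φ
  constructor
  · rintro ⟨f, hf, rfl⟩
    exact hf.2
  · intro hφ
    obtain ⟨f, hf, rfl⟩ := h hφ
    exact ⟨f, ⟨hf, hφ⟩, rfl⟩

/-- Merge-freeness makes the annotation of the principal formula unique. Hence traces leaving `φ`
start from the same annotated formula even if `φ` also belongs to the context. -/
theorem forms_eq_insert_lift {S : RSeq P V} (hS : MergeFree S) {φ : Form P V}
    {Γ : Set (Form P V)} (h : Prod.fst '' S.forms = insert φ Γ) :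
    ∃ σ, S.forms = insert (φ, σ) (lift S Γ) ∧ Prod.fst '' lift S Γ = Γ ∧
      ∀ g ∈ S.forms, g.1 = φ → g = (φ, σ) := by
  obtain ⟨⟨φ', σ⟩, hf, h1⟩ : φ ∈ Prod.fst '' S.forms := h ▸ Set.mem_insert _ _
  simp only at h1
  subst h1
  have huniq : ∀ g ∈ S.forms, g.1 = φ' → g = (φ', σ) := by
    rintro ⟨ψ, τ⟩ hg h1
    simp only at h1
    subst h1
    rw [hS _ _ _ hf hg]
  refine ⟨σ, ?_, image_lift (h ▸ Set.subset_insert _ _), huniq⟩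
  ext g
  constructor
  · intro hg
    have h2 : g.1 ∈ insert φ' Γ := h ▸ Set.mem_image_of_mem _ hg
    rcases h2 with h2 | h2
    · exact Or.inl (huniq g hg h2)
    · exact Or.inr ⟨hg, h2⟩
  · rintro (rfl | hg)
    · exact hf
    · exact hg.1

/-- `S'` follows the move from `S` to a premise with formulas `Γ'`, where `T χ y v χ'` are the trace
steps. -/
structure FollowStep (S S' : RSeq P V) (Γ' : KSeq P V)
    (T : Form P V → V → Fin 3 → Form P V → Prop) : Prop where
  forms : Prod.fst '' S'.forms = Γ'.forms
  ctrl : ∃ a ≤ S.ctrl.length, a ∉ S.ctrl ∧ S'.ctrl.Sublist (S.ctrl ++ [a])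
  word : ∀ g ∈ S.forms, ∀ y v χ', T g.1 y v χ' → y ∈ χ'.nuVars → v ≤ 1 →
    ∃ g' ∈ S'.forms, g'.1 = χ' ∧ (v = 0 → g'.2 y = g.2 y) ∧
      (v = 1 → ∃ a, a ∉ S.ctrl ∧ g'.2 y = g.2 y ++ [a])

theorem exists_fresh_sublist {Θ Θ' : List ℕ} (h : Θ'.Sublist Θ) :
    ∃ a ≤ Θ.length, a ∉ Θ ∧ Θ'.Sublist (Θ ++ [a]) :=
  let ⟨a, h1, h2⟩ := exists_fresh_le Θ
  ⟨a, h1, h2, h.trans (List.sublist_append_left _ _)⟩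

/-- The trace steps of a rule. -/
def KRule.TraceStep (r : KRule P V) (i : ℕ) (χ : Form P V) (y : V) (v : Fin 3)
    (χ' : Form P V) : Prop :=
  (χ ∈ r.context ∧ χ' = χ ∧ v = 0) ∨ (r.Results i χ χ' ∧ v = r.value y)

/-- The rule `r` simulates the rule `k` of `K_μ`. -/
def Simulates (S : RSeq P V) (k : KRule P V) (r : RRule P V) : Prop :=
  r.conc = S ∧ r.prem.length = k.prem.length ∧
    ∀ i (h : i < r.prem.length) (h' : i < k.prem.length),
      FollowStep S r.prem[i] k.prem[i] (k.TraceStep i)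

/-- The corresponding reset rule acts on the unique annotation of the principal formula. A trace
step of value `0` preserves the sequence of its variable, and one of value `1` appends a fresh
letter; steps of value `2` are left unconstrained. -/
theorem exists_simulates {S : RSeq P V} (hS : MergeFree S) (k : KRule P V)
    (h : Prod.fst '' S.forms = k.conc.forms) : ∃ r, Simulates S k r := by
  classical
  have h01 : (0 : Fin 3) ≠ 1 := by decide
  have hone : ∀ {S' : RSeq P V} {Γ' : KSeq P V} {T : ℕ → Form P V → V → Fin 3 → Form P V → Prop},
      FollowStep S S' Γ' (T 0) → ∀ i (h : i < [S'].length) (h' : i < [Γ'].length),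
      FollowStep S [S'][i] [Γ'][i] (T i) := by
    intro S' Γ' T h1 i h h'
    obtain rfl : i = 0 := by simpa using h
    exact h1
  cases k with
  | ax c l hc =>
    refine ⟨RRule.ax S l ?_, rfl, rfl, fun i h => absurd h (Nat.not_lt_zero i)⟩
    have h1 : Prod.fst '' S.forms = {Form.lit l, Form.nlit l} := h.trans hc
    have h2 : ∀ f ∈ S.forms, f.1 = Form.lit l ∨ f.1 = Form.nlit l := fun f hf => by
      have : f.1 ∈ ({Form.lit l, Form.nlit l} : Set (Form P V)) := h1 ▸ Set.mem_image_of_mem _ hf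
      exact this
    have h3 : ∀ f ∈ S.forms, f = (f.1, fun _ => []) := by
      intro f hf
      refine Prod.ext rfl (funext fun x => S.support f hf x ?_)
      rcases h2 f hf with h | h <;> rw [h] <;> exact Set.notMem_empty x
    ext f
    constructor
    · intro hf
      rw [h3 f hf]
      rcases h2 f hf with h | h <;> rw [h] <;> simp
    · have h4 : ∀ φ ∈ ({Form.lit l, Form.nlit l} : Set (Form P V)),
          (φ, fun _ => []) ∈ S.forms := by
        intro φ hφ
        rw [← h1] at hφ
        obtain ⟨g, hg, rfl⟩ := hφ
        rw [← h3 g hg]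
        exact hg
      rintro (rfl | rfl)
      · exact h4 _ (by simp)
      · exact h4 _ (by simp)
  | wk c p Γ φ hc hp =>
    obtain ⟨σ, h1, h2, h3⟩ := forms_eq_insert_lift hS (h.trans hc)
    have hgood : ∀ f ∈ lift S Γ, GoodAnn S.ctrl f := fun f hf => S.goodAnn hf.1
    let S' := annSeq (prune S.ctrl (lift S Γ)) (lift S Γ) p
      ((prune_sublist _ _).nodup S.nodup) (S.finite.subset fun f hf => hf.1) (h2.trans hp.symm)
      (goodAnn_prune hgood)
    refine ⟨RRule.wk S S' (lift S Γ) φ σ h1 rfl rfl, rfl, rfl, hone ⟨h2.trans hp.symm,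
      exists_fresh_sublist (prune_sublist _ _), ?_⟩⟩
    rintro g hg y v χ' (⟨h4, rfl, rfl⟩ | ⟨h4, -⟩) hy hv
    · exact ⟨g, ⟨hg, h4⟩, rfl, fun _ => rfl, fun h => (h01 h).elim⟩
    · exact h4.elim
  | or c p Γ φ ψ hc hp =>
    obtain ⟨σ, h1, h2, h3⟩ := forms_eq_insert_lift hS (h.trans hc)
    have hσ : (Form.or φ ψ, σ) ∈ S.forms := h1 ▸ Set.mem_insert _ _
    set F : Set (AForm P V) := insert (φ, restrict σ φ) (insert (ψ, restrict σ ψ) (lift S Γ))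
      with hF
    have hgood : ∀ f ∈ F, GoodAnn S.ctrl f := by
      rintro f (rfl | rfl | hf)
      · exact (S.goodAnn hσ).restrict _
      · exact (S.goodAnn hσ).restrict _
      · exact S.goodAnn hf.1
    have himg : Prod.fst '' F = p.forms := by
      rw [hF, Set.image_insert_eq, Set.image_insert_eq, h2, hp]
    let S' := annSeq S.ctrl F p S.nodup
      (((S.finite.subset fun f hf => hf.1).insert _).insert _) himg hgood
    refine ⟨RRule.or S S' (lift S Γ) φ ψ σ h1 rfl rfl, rfl, rfl, hone ⟨himg,
      exists_fresh_sublist (List.Sublist.refl _), ?_⟩⟩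
    rintro g hg y v χ' (⟨h4, rfl, rfl⟩ | ⟨⟨h4, h5⟩, rfl⟩) hy hv
    · exact ⟨g, Or.inr (Or.inr ⟨hg, h4⟩), rfl, fun _ => rfl, fun h => (h01 h).elim⟩
    · obtain rfl := h3 g hg h4
      rcases h5 with rfl | rfl
      · exact ⟨_, Or.inl rfl, rfl, fun _ => restrict_apply hy,
          fun h => (h01 h).elim⟩
      · exact ⟨_, Or.inr (Or.inl rfl), rfl, fun _ => restrict_apply hy,
          fun h => (h01 h).elim⟩
  | and c p q Γ φ ψ hc hp hq =>
    obtain ⟨σ, h1, h2, h3⟩ := forms_eq_insert_lift hS (h.trans hc)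
    have hσ : (Form.and φ ψ, σ) ∈ S.forms := h1 ▸ Set.mem_insert _ _
    have hgood : ∀ χ, ∀ f ∈ insert (χ, restrict σ χ) (lift S Γ), GoodAnn S.ctrl f := by
      rintro χ f (rfl | hf)
      · exact (S.goodAnn hσ).restrict _
      · exact S.goodAnn hf.1
    have himg : ∀ χ : Form P V, Prod.fst '' insert (χ, restrict σ χ) (lift S Γ) = insert χ Γ := by
      intro χ
      rw [Set.image_insert_eq, h2]
    have hfin : ∀ χ : Form P V, (insert (χ, restrict σ χ) (lift S Γ)).Finite :=
      fun χ => (S.finite.subset fun f hf => hf.1).insert _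
    let S₁ := annSeq (prune S.ctrl (insert (φ, restrict σ φ) (lift S Γ)))
      (insert (φ, restrict σ φ) (lift S Γ)) p
      ((prune_sublist _ _).nodup S.nodup) (hfin φ) ((himg φ).trans hp.symm)
      (goodAnn_prune (hgood φ))
    let S₂ := annSeq (prune S.ctrl (insert (ψ, restrict σ ψ) (lift S Γ)))
      (insert (ψ, restrict σ ψ) (lift S Γ)) q
      ((prune_sublist _ _).nodup S.nodup) (hfin ψ) ((himg ψ).trans hq.symm)
      (goodAnn_prune (hgood ψ))
    refine ⟨RRule.and S S₁ S₂ (lift S Γ) φ ψ σ h1 rfl rfl rfl rfl, rfl, rfl, ?_⟩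
    intro i hi hi'
    have hi2 : i = 0 ∨ i = 1 := by
      have : i < 2 := hi
      omega
    rcases hi2 with rfl | rfl
    · refine ⟨(himg φ).trans hp.symm, exists_fresh_sublist (prune_sublist _ _), ?_⟩
      rintro g hg y v χ' (⟨h4, rfl, rfl⟩ | ⟨⟨h4, h5⟩, rfl⟩) hy hv
      · exact ⟨g, Or.inr ⟨hg, h4⟩, rfl, fun _ => rfl, fun h => (h01 h).elim⟩
      · obtain rfl := h3 g hg h4
        rcases h5 with ⟨-, rfl⟩ | ⟨h5, -⟩
        · exact ⟨_, Or.inl rfl, rfl, fun _ => restrict_apply hy,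
            fun h => (h01 h).elim⟩
        · exact absurd h5 (by decide)
    · refine ⟨(himg ψ).trans hq.symm, exists_fresh_sublist (prune_sublist _ _), ?_⟩
      rintro g hg y v χ' (⟨h4, rfl, rfl⟩ | ⟨⟨h4, h5⟩, rfl⟩) hy hv
      · exact ⟨g, Or.inr ⟨hg, h4⟩, rfl, fun _ => rfl, fun h => (h01 h).elim⟩
      · obtain rfl := h3 g hg h4
        rcases h5 with ⟨h5, -⟩ | ⟨-, rfl⟩
        · exact absurd h5 (by decide)
        · exact ⟨_, Or.inl rfl, rfl, fun _ => restrict_apply hy,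
            fun h => (h01 h).elim⟩
  | mod c p Γ φ hc hp =>
    obtain ⟨σ, h1, h2, h3⟩ := forms_eq_insert_lift hS (h.trans hc)
    have hσ : (Form.box φ, σ) ∈ S.forms := h1 ▸ Set.mem_insert _ _
    let dia' : AForm P V → AForm P V := fun f => (Form.dia f.1, f.2)
    -- The annotated context of the premise, obtained by stripping the diamonds.
    set L : Set (AForm P V) := {f | dia' f ∈ S.forms ∧ f.1 ∈ Γ} with hL
    have hinj : Function.Injective dia' := by
      rintro ⟨f, s⟩ ⟨g, t⟩ h
      simp only [dia', Prod.mk.injEq, Form.dia.injEq] at h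
      rw [h.1, h.2]
    have hLfin : L.Finite :=
      (S.finite.preimage hinj.injOn).subset fun f hf => hf.1
    have hLimg : dia' '' L = lift S (Form.dia '' Γ) := by
      ext g
      constructor
      · rintro ⟨f, hf, rfl⟩
        exact ⟨hf.1, f.1, hf.2, rfl⟩
      · rintro ⟨hg, ψ, hψ, h4⟩
        have h5 : dia' (ψ, g.2) = g := Prod.ext h4 rfl
        exact ⟨(ψ, g.2), ⟨by rw [h5]; exact hg, hψ⟩, h5⟩
    have hc' : S.forms = insert (Form.box φ, σ) (dia' '' L) := by rw [hLimg]; exact h1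
    have hfst : Prod.fst '' L = Γ := by
      ext ψ
      constructor
      · rintro ⟨f, hf, rfl⟩
        exact hf.2
      · intro hψ
        have h4 : Form.dia ψ ∈ Prod.fst '' lift S (Form.dia '' Γ) := by
          rw [h2]
          exact Set.mem_image_of_mem _ hψ
        obtain ⟨g, hg, h5⟩ := h4
        have h6 : dia' (ψ, g.2) = g := Prod.ext h5.symm rfl
        exact ⟨(ψ, g.2), ⟨by rw [h6]; exact hg.1, hψ⟩, rfl⟩
    have himg : Prod.fst '' insert (φ, σ) L = p.forms := by
      rw [Set.image_insert_eq, hfst, hp]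
    have hgood : ∀ f ∈ insert (φ, σ) L, GoodAnn S.ctrl f := by
      rintro f (rfl | hf)
      · intro x
        exact S.goodAnn hσ x
      · exact S.goodAnn (f := dia' f) hf.1
    let S' := annSeq S.ctrl (insert (φ, σ) L) p S.nodup (hLfin.insert _) himg hgood
    refine ⟨RRule.mod S S' L φ σ hc' rfl rfl, rfl, rfl, hone ⟨himg,
      exists_fresh_sublist (List.Sublist.refl _), ?_⟩⟩
    rintro g hg y v χ' (⟨h4, rfl, rfl⟩ | ⟨⟨h4, rfl⟩ | ⟨h4, h5⟩, rfl⟩) hy hv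
    · exact h4.elim
    · obtain rfl := h3 g hg h4
      exact ⟨_, Or.inl rfl, rfl, fun _ => rfl,
        fun h => (h01 h).elim⟩
    · have h6 : dia' (χ', g.2) = g := Prod.ext h4.symm rfl
      exact ⟨(χ', g.2), Or.inr ⟨by rw [h6]; exact hg, h5⟩, rfl, fun _ => rfl,
        fun h => (h01 h).elim⟩
  | mu c p Γ x φ hx hc hp =>
    obtain ⟨σ, h1, h2, h3⟩ := forms_eq_insert_lift hS (h.trans hc)
    have hσ : (Form.mu x φ, σ) ∈ S.forms := h1 ▸ Set.mem_insert _ _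
    set F : Set (AForm P V) := insert (Form.unfoldMu x φ, eraseMu σ x φ) (lift S Γ) with hF
    have hgood : ∀ f ∈ F, GoodAnn S.ctrl f := by
      rintro f (rfl | hf)
      · intro y
        have h4 := S.goodAnn hσ y
        by_cases h5 : (Form.mu x φ).Subsumes x y
        · simp [eraseMu, h5]
        · simp only [eraseMu, h5, if_false]
          exact ⟨fun h => h4.1 fun h' => h (Form.nuVars_subset_nuVars_subst x _ φ h'), h4.2⟩
      · exact S.goodAnn hf.1
    have himg : Prod.fst '' F = p.forms := by
      rw [hF, Set.image_insert_eq, h2, hp]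
    let S' := annSeq (prune S.ctrl F) F p ((prune_sublist _ _).nodup S.nodup)
      ((S.finite.subset fun f hf => hf.1).insert _) himg (goodAnn_prune hgood)
    refine ⟨RRule.mu S S' (lift S Γ) x φ σ hx h1 rfl rfl, rfl, rfl, hone ⟨himg,
      exists_fresh_sublist (prune_sublist _ _), ?_⟩⟩
    rintro g hg y v χ' (⟨h4, rfl, rfl⟩ | ⟨⟨h4, rfl⟩, rfl⟩) hy hv
    · exact ⟨g, Or.inr ⟨hg, h4⟩, rfl, fun _ => rfl, fun h => (h01 h).elim⟩
    · obtain rfl := h3 g hg h4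
      -- The sequence of `y` is erased only if `x` subsumes `y`. The value is then `2`, so both
      -- clauses hold vacuously.
      refine ⟨_, Or.inl rfl, rfl, ?_, ?_⟩
      · by_cases h5 : (Form.mu x φ).Subsumes x y
        · simp [KRule.value, h5]
        · simp [eraseMu, h5]
      · by_cases h5 : (Form.mu x φ).Subsumes x y
        · simp [KRule.value, h5]
        · simp [KRule.value, h5]
  | nu c p Γ x φ hx hc hp =>
    obtain ⟨σ, h1, h2, h3⟩ := forms_eq_insert_lift hS (h.trans hc)
    have hσ : (Form.nu x φ, σ) ∈ S.forms := h1 ▸ Set.mem_insert _ _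
    obtain ⟨a, ha, haS⟩ := exists_fresh_le S.ctrl
    set F : Set (AForm P V) := insert (Form.unfoldNu x φ, extendNu σ x a φ) (lift S Γ) with hF
    have hgood : ∀ f ∈ F, GoodAnn (S.ctrl ++ [a]) f := by
      rintro f (rfl | hf)
      · intro y
        refine ⟨fun h => if_neg h, ?_⟩
        by_cases h5 : y ∈ (Form.unfoldNu x φ).nuVars
        · simp only [extendNu, restrict_apply h5]
          by_cases h6 : y = x
          · subst h6
            rw [Function.update_self]
            exact (S.goodAnn hσ y).2.append (List.Sublist.refl _)
          · rw [Function.update_of_ne h6]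
            exact (S.goodAnn hσ y).2.trans (List.sublist_append_left _ _)
        · simp [extendNu, restrict, h5]
      · exact fun y => ⟨(S.goodAnn hf.1 y).1,
          (S.goodAnn hf.1 y).2.trans (List.sublist_append_left _ _)⟩
    have himg : Prod.fst '' F = p.forms := by
      rw [hF, Set.image_insert_eq, h2, hp]
    have hnd : (S.ctrl ++ [a]).Nodup := by
      rw [List.nodup_append]
      refine ⟨S.nodup, by simp, fun b hb c hc => ?_⟩
      rintro rfl
      rw [List.mem_singleton.1 hc] at hb
      exact haS hb
    let S' := annSeq (S.ctrl ++ [a]) F p hnd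
      ((S.finite.subset fun f hf => hf.1).insert _) himg hgood
    refine ⟨RRule.nu S S' (lift S Γ) x φ σ a haS hx h1 rfl rfl, rfl, rfl, hone ⟨himg,
      ⟨a, ha, haS, List.Sublist.refl _⟩, ?_⟩⟩
    rintro g hg y v χ' (⟨h4, rfl, rfl⟩ | ⟨⟨h4, rfl⟩, rfl⟩) hy hv
    · exact ⟨g, Or.inr ⟨hg, h4⟩, rfl, fun _ => rfl, fun h => (h01 h).elim⟩
    · obtain rfl := h3 g hg h4
      refine ⟨_, Or.inl rfl, rfl, ?_, ?_⟩
      · by_cases h5 : y = x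
        · simp [KRule.value, h5]
        · intro _
          simp only [extendNu, restrict_apply hy]
          rw [Function.update_of_ne h5]
      · by_cases h5 : y = x
        · subst h5
          intro _
          refine ⟨a, haS, ?_⟩
          simp only [extendNu, restrict_apply hy]
          rw [Function.update_self]
        · simp [KRule.value, h5]

/-- A weakening by a formula which stays in the context. -/
theorem exists_idle_step {S : RSeq P V} {Γ : KSeq P V} (hΓ : Prod.fst '' S.forms = Γ.forms)
    (hne : Γ.forms.Nonempty) : ∃ (r : RRule P V) (S' : RSeq P V), r.conc = S ∧ r.prem = [S'] ∧
      FollowStep S S' Γ (fun χ _ v χ' => χ' = χ ∧ v = 0) := by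
  rw [← hΓ] at hne
  obtain ⟨_, ⟨φ, σ⟩, hf, -⟩ := hne
  let S' := annSeq (prune S.ctrl S.forms) S.forms Γ ((prune_sublist _ _).nodup S.nodup) S.finite
    hΓ (goodAnn_prune fun f hf => S.goodAnn hf)
  refine ⟨RRule.wk S S' S.forms φ σ (Set.insert_eq_of_mem hf).symm rfl rfl, S', rfl, rfl, hΓ,
    exists_fresh_sublist (prune_sublist _ _), ?_⟩
  rintro g hg y v χ' ⟨rfl, rfl⟩ _ _
  exact ⟨g, hg, rfl, fun _ => rfl, fun h => absurd h (by decide)⟩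

end Simulation

section Play

variable {P V : Type*}

/-! ## The strategy -/

theorem FollowStep.mono {S S' : RSeq P V} {Γ' : KSeq P V}
    {T T' : Form P V → V → Fin 3 → Form P V → Prop} (h : FollowStep S S' Γ' T)
    (hT : ∀ χ y v χ', T' χ y v χ' → T χ y v χ') : FollowStep S S' Γ' T' :=
  ⟨h.forms, h.ctrl, fun g hg y v χ' h' => h.word g hg y v χ' (hT _ _ _ _ h')⟩

/-- The trace values of all sequents of a preproof. -/
def allValues (Q : Preproof (KSystem P V)) : Set (Form P V × V) :=
  ⋃ t ∈ Q.nodes, (traceValues (Q.label t)).carrier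

theorem allValues_finite (Q : Preproof (KSystem P V)) : (allValues Q).Finite :=
  Q.finite.biUnion fun t _ => (traceValues (Q.label t)).finite

/-- The number of trace values of a preproof. -/
noncomputable def numValues (Q : Preproof (KSystem P V)) : ℕ := (allValues_finite Q).toFinset.card

/-- Each uncovered letter ends the sequence of some trace value. Since a formula has only one
annotation, different letters need different trace values. -/
theorem Normal.length_ctrl_le {S : RSeq P V} (hS : Normal S) {Q : Preproof (KSystem P V)}
    {t : List ℕ} (ht : t ∈ Q.nodes) (h : Prod.fst '' S.forms = (Q.label t).forms) :
    S.ctrl.length ≤ numValues Q := by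
  classical
  have hlast : ∀ a ∈ S.ctrl, ∃ f : AForm P V, ∃ x, f ∈ S.forms ∧ x ∈ f.1.nuVars ∧
      (f.2 x).getLast? = some a := by
    intro a ha
    have := hS.2 a ha
    simp only [Covered, not_forall, not_not] at this
    obtain ⟨f, hf, x, hx, -, h⟩ := this
    exact ⟨f, x, hf, hx, h⟩
  -- A default trace value is needed to choose `p` on all letters; if there is none, the control is
  -- empty.
  rcases isEmpty_or_nonempty (Form P V × V) with he | hne
  · have : S.ctrl = [] := by
      by_contra hnil
      obtain ⟨a, ha⟩ := List.exists_mem_of_ne_nil _ hnil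
      obtain ⟨f, x, -⟩ := hlast a ha
      exact he.false (f.1, x)
    simp [this]
  have hval : ∀ a ∈ S.ctrl, ∃ v : Form P V × V, v ∈ allValues Q ∧
      ∃ f ∈ S.forms, f.1 = v.1 ∧ (f.2 v.2).getLast? = some a := by
    intro a ha
    obtain ⟨f, x, hf, hx, h1⟩ := hlast a ha
    exact ⟨(f.1, x), Set.mem_biUnion ht ⟨h ▸ Set.mem_image_of_mem _ hf, hx⟩, f, hf, rfl, h1⟩
  choose! p hp hp' using hval
  rw [← List.toFinset_card_of_nodup S.nodup]
  refine Finset.card_le_card_of_injOn p (fun a ha => ?_) ?_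
  · exact (allValues_finite Q).mem_toFinset.2 (hp a (List.mem_toFinset.1 ha))
  · intro a ha b hb hab
    obtain ⟨⟨φ, σ⟩, hf, h1, h2⟩ := hp' a (List.mem_toFinset.1 ha)
    obtain ⟨⟨ψ, τ⟩, hg, h3, h4⟩ := hp' b (List.mem_toFinset.1 hb)
    simp only at h1 h2 h3 h4
    rw [hab, ← h3] at h1
    subst h1
    rw [hS.1 _ _ _ hf hg, hab, h4] at h2
    exact (Option.some.inj h2).symm

/-- A state of the strategy: a node of a proof in `K_μ` and an annotation of its sequent. -/
structure PlayState (Q : Preproof (KSystem P V)) where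
  seq : RSeq P V
  node : List ℕ
  mem : node ∈ Q.nodes
  forms : Prod.fst '' seq.forms = (Q.label node).forms
  bound : ∀ a ∈ seq.ctrl, a < numValues Q + 1

/-- A move from `s` to `s'` follows the given proof. -/
def ActiveStep {Q : Preproof (KSystem P V)} (s s' : PlayState Q) : Prop :=
  ((¬ Q.IsLeaf s.node ∧ ∃ i, s'.node = s.node ++ [i]) ∨ Q.back s.node = some s'.node) ∧
    FollowStep s.seq s'.seq (Q.label s'.node)
      (fun χ y v χ' => ((χ, y), v, (χ', y)) ∈ moveRel Q s.node s'.node)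

/-- A move by which the rule `r` is applied. -/
def PlayStep {Q : Preproof (KSystem P V)} (s : PlayState Q) (r : RRule P V)
    (s' : PlayState Q) : Prop :=
  (SilentStep s.seq s'.seq r ∧ s'.node = s.node) ∨ ActiveStep s s'

theorem exists_play_of_silentStep {Q : Preproof (KSystem P V)} (s : PlayState Q)
    (h : ∃ r S', SilentStep s.seq S' r) : ∃ r : RRule P V, r.conc = s.seq ∧
      ∀ i (h : i < r.prem.length), ∃ s' : PlayState Q, s'.seq = r.prem[i] ∧ PlayStep s r s' := by
  obtain ⟨r, S', hr⟩ := h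
  refine ⟨r, hr.conc, fun i hi => ?_⟩
  have hi0 : i = 0 := by
    have := hi
    rw [hr.prem] at this
    simpa using this
  subst hi0
  exact ⟨⟨S', s.node, s.mem, hr.forms.trans s.forms,
    fun a ha => s.bound a (hr.ctrl.subset ha)⟩, by simp [hr.prem], Or.inl ⟨hr, rfl⟩⟩

theorem KRule.conc_nonempty (r : KRule P V) : r.conc.forms.Nonempty := by
  cases r with
  | ax c l hc => exact ⟨_, hc ▸ Set.mem_insert _ _⟩
  | wk c p Γ φ hc => exact ⟨_, hc ▸ Set.mem_insert _ _⟩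
  | or c p Γ φ ψ hc => exact ⟨_, hc ▸ Set.mem_insert _ _⟩
  | and c p q Γ φ ψ hc => exact ⟨_, hc ▸ Set.mem_insert _ _⟩
  | mod c p Γ φ hc => exact ⟨_, hc ▸ Set.mem_insert _ _⟩
  | mu c p Γ x φ hx hc => exact ⟨_, hc ▸ Set.mem_insert _ _⟩
  | nu c p Γ x φ hx hc => exact ⟨_, hc ▸ Set.mem_insert _ _⟩

/-- A companion is an inner node, hence the conclusion of a rule, and no rule has an empty
conclusion. The idle weakening needs a formula to act on. -/
theorem label_nonempty_of_back {Q : Preproof (KSystem P V)} {t c : List ℕ}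
    (h : Q.back t = some c) : (KSeq.forms (Q.label c)).Nonempty := by
  have hc : c ∈ Q.nodes := Q.prefix_closed (Q.back_bud h).1 (Q.back_lt h).1
  obtain ⟨i, hi⟩ := Q.back_inner h
  have hb : Q.back c = none := by
    by_contra hne
    obtain ⟨d, hd⟩ := Option.ne_none_iff_exists'.1 hne
    exact (Q.back_bud hd).2 i hi
  cases hr : Q.rule c with
  | none => exact absurd hi (Q.no_rule hc hb hr i)
  | some r =>
    rw [Q.rule_conc hr]
    exact r.conc_nonempty

/-- The new letter is at most the length of the old control. Normality makes that length at most
`numValues Q`, so the alphabet of a `PlayState` is preserved. -/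
theorem FollowStep.ctrl_lt {S S' : RSeq P V} {Γ' : KSeq P V}
    {T : Form P V → V → Fin 3 → Form P V → Prop} (h : FollowStep S S' Γ' T) {B : ℕ}
    (hB : S.ctrl.length ≤ B) (hS : ∀ a ∈ S.ctrl, a < B + 1) : ∀ a ∈ S'.ctrl, a < B + 1 := by
  obtain ⟨b, hb, -, hsub⟩ := h.ctrl
  intro a ha
  rcases List.mem_append.1 (hsub.subset ha) with h | h
  · exact hS a h
  · rw [List.mem_singleton.1 h]
    omega

/-- In every state the strategy applies some rule. -/
theorem exists_play {Q : Preproof (KSystem P V)} (hQ : Q.NoAssumptions) (s : PlayState Q) :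
    ∃ r : RRule P V, r.conc = s.seq ∧
      ∀ i (h : i < r.prem.length), ∃ s' : PlayState Q, s'.seq = r.prem[i] ∧ PlayStep s r s' := by
  by_cases h1 : MergeFree s.seq
  swap
  · exact exists_play_of_silentStep s (exists_merge_step s.forms h1)
  by_cases h2 : ∀ a ∈ s.seq.ctrl, ¬ Covered a s.seq.forms
  swap
  · push Not at h2
    obtain ⟨a, ha, hcov⟩ := h2
    exact exists_play_of_silentStep s (exists_reset_step s.forms ha hcov)
  have hlen := Normal.length_ctrl_le ⟨h1, h2⟩ s.mem s.forms
  cases hb : Q.back s.node with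
  | some c =>
    have hc : c ∈ Q.nodes := Q.prefix_closed (Q.back_bud hb).1 (Q.back_lt hb).1
    have hforms : Prod.fst '' s.seq.forms = (Q.label c).forms := by
      rw [s.forms, Q.label_back hb]
    -- Moving from a bud to its companion leaves the sequent of `Q` unchanged, but a play must apply
    -- a rule at each move; an idle weakening fills the gap.
    obtain ⟨r, S', h3, h4, h5⟩ := exists_idle_step hforms (label_nonempty_of_back hb)
    refine ⟨r, h3, fun i hi => ?_⟩
    have hi0 : i = 0 := by
      have := hi
      rw [h4] at this
      simpa using this
    subst hi0
    refine ⟨⟨S', c, hc, h5.forms, h5.ctrl_lt hlen s.bound⟩, by simp [h4],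
      Or.inr ⟨Or.inr hb, h5.mono ?_⟩⟩
    rintro χ y v χ' (⟨k, i, _, h6, _⟩ | ⟨-, -, h6, h7⟩)
    · exact absurd hb (by rw [(Q.rule_dom h6).2]; simp)
    · exact ⟨congrArg Prod.fst h7, h6⟩
  | none =>
    cases hr : Q.rule s.node with
    | none =>
      exfalso
      have hleaf : Q.IsLeaf s.node := ⟨s.mem, Q.no_rule s.mem hb hr⟩
      rcases hQ _ hleaf with h | h
      · exact h hb
      · exact h hr
    | some k =>
      have hforms : Prod.fst '' s.seq.forms = k.conc.forms := by
        rw [s.forms, Q.rule_conc hr]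
      obtain ⟨r, h3, h4, h5⟩ := exists_simulates h1 k hforms
      refine ⟨r, h3, fun i hi => ?_⟩
      have hi' : i < k.prem.length := h4 ▸ hi
      have hmem : s.node ++ [i] ∈ Q.nodes := (Q.rule_children hr i).2 hi'
      have h6 := h5 i hi hi'
      have hlab : Q.label (s.node ++ [i]) = k.prem[i] := Q.rule_prem hr i hi'
      rw [← hlab] at h6
      refine ⟨⟨r.prem[i], s.node ++ [i], hmem, h6.forms, h6.ctrl_lt hlen s.bound⟩, rfl,
        Or.inr ⟨Or.inl ⟨fun hl => hl.2 i hmem, i, rfl⟩, h6.mono ?_⟩⟩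
      rintro χ y v χ' (⟨k', i', _, h7, h8, h9⟩ | ⟨h7, -⟩)
      · rw [hr] at h7
        obtain rfl := Option.some.inj h7
        obtain rfl : i = i' := by simpa using h8
        exact h9.2.2.2
      · exact absurd hmem (h7.2 i)

/-! ## Finitely many annotated sequents -/

theorem finite_nodup_lists (B : ℕ) : {l : List ℕ | l.Nodup ∧ ∀ a ∈ l, a < B}.Finite := by
  refine (List.finite_toSet ((List.range B).sublists.flatMap List.permutations)).subset ?_
  rintro l ⟨h1, h2⟩
  obtain ⟨l', h3, h4⟩ := h1.subperm (fun a ha => List.mem_range.2 (h2 a ha))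
  exact List.mem_flatMap.2 ⟨l', List.mem_sublists.2 h4, List.mem_permutations.2 h3.symm⟩

theorem finite_annotations (φ : Form P V) {T : Set (List ℕ)} (hT : T.Finite) :
    {σ : V → List ℕ | (∀ x, x ∉ φ.nuVars → σ x = []) ∧ ∀ x, σ x ∈ T}.Finite := by
  have : Finite φ.nuVars := φ.nuVars_finite
  have : Finite T := hT
  refine Set.finite_coe_iff.1 (Finite.of_injective
    (fun σ => (fun x => ⟨σ.1 x, σ.2.2 x⟩ : φ.nuVars → T)) ?_)
  rintro ⟨σ, hσ⟩ ⟨τ, hτ⟩ h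
  refine Subtype.ext (funext fun x => ?_)
  by_cases hx : x ∈ φ.nuVars
  · exact congrArg Subtype.val (congrFun h ⟨x, hx⟩)
  · exact (hσ.1 x hx).trans (hτ.1 x hx).symm

theorem finite_sequents (F : Set (Form P V)) (hF : F.Finite) (B : ℕ) :
    {S : RSeq P V | (∀ f ∈ S.forms, f.1 ∈ F) ∧ ∀ a ∈ S.ctrl, a < B}.Finite := by
  set T := {l : List ℕ | l.Nodup ∧ ∀ a ∈ l, a < B} with hT
  have hTf : T.Finite := finite_nodup_lists B
  have hA : (⋃ φ ∈ F, Prod.mk φ ''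
      {σ : V → List ℕ | (∀ x, x ∉ φ.nuVars → σ x = []) ∧ ∀ x, σ x ∈ T}).Finite :=
    hF.biUnion fun φ _ => (finite_annotations φ hTf).image _
  refine ((hTf.prod hA.finite_subsets).preimage
    (f := fun S : RSeq P V => (S.ctrl, S.forms)) ?_).subset ?_
  · intro S _ S' _ h
    exact RSeq.ext (congrArg Prod.fst h) (congrArg Prod.snd h)
  · rintro S ⟨h1, h2⟩
    refine ⟨⟨S.nodup, h2⟩, fun f hf => ?_⟩
    refine Set.mem_biUnion (h1 f hf) ⟨f.2, ⟨S.support f hf, fun x => ?_⟩, rfl⟩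
    exact ⟨(S.sublist f hf x).nodup S.nodup, fun a ha => h2 a ((S.sublist f hf x).subset ha)⟩

theorem PlayState.finite_seqs (Q : Preproof (KSystem P V)) :
    (Set.range fun s : PlayState Q => s.seq).Finite := by
  refine (finite_sequents (⋃ t ∈ Q.nodes, (Q.label t).forms)
    (Q.finite.biUnion fun t _ => (Q.label t).finite) (numValues Q + 1)).subset ?_
  rintro _ ⟨s, rfl⟩
  exact ⟨fun f hf => Set.mem_biUnion s.mem (s.forms ▸ Set.mem_image_of_mem _ hf), s.bound⟩

theorem PlayState.length_ctrl_le {Q : Preproof (KSystem P V)} (s : PlayState Q) :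
    s.seq.ctrl.length ≤ numValues Q + 1 := by
  have := (s.seq.nodup.subperm
    (fun a ha => List.mem_range.2 (s.bound a ha) : s.seq.ctrl ⊆ _)).length_le
  simpa using this

end Play

section Plays

variable {P V : Type*} {Q : Preproof (KSystem P V)}

/-! ## Infinite plays -/

/-- The move from state `n` to state `n + 1` follows the given proof. -/
def activeAt (st : ℕ → PlayState Q) (n : ℕ) : Prop := ActiveStep (st n) (st (n + 1))

/-- A play that is silent from some point on would decrease the size forever. -/
theorem infinite_activeAt {st : ℕ → PlayState Q} {r : ℕ → RRule P V}
    (hst : ∀ n, PlayStep (st n) (r n) (st (n + 1))) :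
    {n | activeAt st n}.Infinite := by
  refine Set.infinite_of_forall_exists_gt fun N => ?_
  by_contra! hno
  have hsilent : ∀ n ≥ N + 1, (st (n + 1)).seq.size < (st n).seq.size := by
    intro n hn
    rcases hst n with h | h
    · exact h.1.size
    · exact absurd hn (not_le.2 (Nat.lt_succ_of_le (hno n h)))
  have key : ∀ k, (st (N + 1 + k)).seq.size + k ≤ (st (N + 1)).seq.size := by
    intro k
    induction k with
    | zero => simp
    | succ k ih =>
      have := hsilent (N + 1 + k) (by omega)
      rw [← add_assoc (N + 1) k 1]
      omega
  have := key ((st (N + 1)).seq.size + 1)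
  omega

open Classical in
/-- The branch of the given proof that is followed by a play. -/
noncomputable def playBranch (st : ℕ → PlayState Q) (k : ℕ) : List ℕ :=
  (st (Nat.nth (activeAt st) k)).node

open Classical in
-- The node changes only at active moves, so it is still the same at the next active time.
theorem playBranch_count {st : ℕ → PlayState Q} {r : ℕ → RRule P V}
    (hst : ∀ n, PlayStep (st n) (r n) (st (n + 1))) (n : ℕ) :
    playBranch st (Nat.count (activeAt st) n) = (st n).node := by
  have hinf : {n | activeAt st n}.Infinite := infinite_activeAt hst
  set m := Nat.nth (activeAt st) (Nat.count (activeAt st) n) with hm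
  have hcm : Nat.count (activeAt st) m = Nat.count (activeAt st) n :=
    Nat.count_nth_of_infinite hinf _
  have hact : activeAt st m := Nat.nth_mem_of_infinite hinf _
  have hnm : n ≤ m := by
    by_contra! hlt
    have h1 : Nat.count (activeAt st) (m + 1) ≤ Nat.count (activeAt st) n :=
      Nat.count_monotone _ hlt
    rw [Nat.count_succ, if_pos hact] at h1
    omega
  have hno : ∀ k, n ≤ k → k < m → ¬ activeAt st k := by
    intro k hk hkm ha
    have h1 : Nat.count (activeAt st) (k + 1) ≤ Nat.count (activeAt st) m :=
      Nat.count_monotone _ hkm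
    have h2 : Nat.count (activeAt st) n ≤ Nat.count (activeAt st) k := Nat.count_monotone _ hk
    rw [Nat.count_succ, if_pos ha] at h1
    omega
  have hconst : ∀ k, n ≤ k → k ≤ m → (st k).node = (st n).node := by
    intro k hk
    induction k, hk using Nat.le_induction with
    | base => exact fun _ => rfl
    | succ k hk ih =>
      intro hkm
      rcases hst k with h | h
      · rw [h.2, ih (by omega)]
      · exact absurd h (hno k hk hkm)
  exact hconst m hnm le_rfl

theorem isBranch_playBranch {st : ℕ → PlayState Q} {r : ℕ → RRule P V}
    (hst : ∀ n, PlayStep (st n) (r n) (st (n + 1))) (h0 : (st 0).node = []) :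
    Q.IsBranch (playBranch st) := by
  classical
  have hinf : {n | activeAt st n}.Infinite := infinite_activeAt hst
  have hmove : ∀ k, (¬ Q.IsLeaf (playBranch st k) ∧
      ∃ i, playBranch st (k + 1) = playBranch st k ++ [i]) ∨
      Q.back (playBranch st k) = some (playBranch st (k + 1)) := by
    intro k
    have h1 : activeAt st (Nat.nth (activeAt st) k) := Nat.nth_mem_of_infinite hinf k
    have h2 := playBranch_count hst (Nat.nth (activeAt st) k + 1)
    rw [Nat.count_succ, if_pos h1, Nat.count_nth_of_infinite hinf] at h2
    rw [h2]
    exact h1.1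
  refine ⟨?_, fun n => (st _).mem, fun n hn => ?_, fun n hn => ?_⟩
  · have := playBranch_count hst 0
    rwa [Nat.count_zero, h0] at this
  · rcases hmove n with h | h
    · exact h.2
    · exact absurd ((Q.back_bud h)) hn
  · rcases hmove n with h | h
    · exact absurd hn h.1
    · exact h

theorem moveRel_mem {t t' : List ℕ} {x : (Form P V × V) × Fin 3 × (Form P V × V)}
    (h : x ∈ moveRel Q t t') : x.1 ∈ (traceValues (Q.label t)).carrier ∧ x.1.2 = x.2.2.2 := by
  rcases h with ⟨r, i, hi, h1, h2, h3⟩ | ⟨h1, h2, h3, h4⟩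
  · rw [Q.rule_conc h1]
    exact ⟨h3.1, h3.2.2.1⟩
  · exact ⟨h2, by rw [h4]⟩

/-- In every infinite play some letter is eventually stable and reset infinitely often. -/
theorem exists_stable_letter_of_play (hQ : Q ∈ (Kmu P V).proofs) {st : ℕ → PlayState Q}
    {r : ℕ → RRule P V} (hst : ∀ n, PlayStep (st n) (r n) (st (n + 1)))
    (h0 : (st 0).node = []) :
    ∃ a N A, (∀ n ≥ N, a ∈ (st n).seq.ctrl ∧
      (st n).seq.ctrl.takeWhile (fun x => x ≠ a) = A) ∧ ∀ N, ∃ n ≥ N, (r n).IsReset a := by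
  classical
  have hinf : {n | activeAt st n}.Infinite := infinite_activeAt hst
  obtain ⟨N, u, b, hu, hb⟩ := exists_branch_trace hQ (isBranch_playBranch hst h0)
  let cnt : ℕ → ℕ := Nat.count (activeAt st)
  have hcnt : Monotone cnt := Nat.count_monotone _
  -- Trace steps never change the variable, so the whole trace is on one variable `y`.
  have hsnd : ∀ k ≥ N, (u k).2 = (u N).2 := by
    intro k hk
    induction k, hk using Nat.le_induction with
    | base => rfl
    | succ k hk ih => rw [← ih]; exact (moveRel_mem (hu k hk).1).2.symm
  set y := (u N).2 with hy
  have hval : ∀ k ≥ N, (u k).1 ∈ (Q.label (playBranch st k)).forms ∧ y ∈ (u k).1.nuVars := by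
    intro k hk
    have := (moveRel_mem (hu k hk).1).1
    refine ⟨this.1, ?_⟩
    rw [← hsnd k hk]
    exact this.2
  have huk : ∀ k ≥ N, u k = ((u k).1, y) := fun k hk => Prod.ext rfl (hsnd k hk)
  set n₀ := Nat.nth (activeAt st) N with hn₀
  have hcn₀ : cnt n₀ = N := Nat.count_nth_of_infinite hinf N
  -- `g` annotates the trace formula at time `n` of the play; `cnt n` active moves have been made by
  -- then, so the branch is at position `cnt n`.
  let Tr : ℕ → AForm P V → Prop := fun n g => g ∈ (st n).seq.forms ∧ g.1 = (u (cnt n)).1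
  have hstart : ∃ g, Tr n₀ g := by
    have h1 := (hval N le_rfl).1
    rw [← hcn₀, playBranch_count hst, ← (st n₀).forms] at h1
    obtain ⟨g, hg, h1⟩ := h1
    exact ⟨g, hg, h1⟩
  have hstep : ∀ n, n₀ ≤ n → ∀ g, Tr n g → ∃ g', Tr (n + 1) g' ∧
      WordStep (st n).seq.ctrl (fun a => (r n).IsReset a) (g.2 y) (g'.2 y) ∧
      (activeAt st n → b (cnt n) = 1 →
        ∃ a, a ∉ (st n).seq.ctrl ∧ g'.2 y = g.2 y ++ [a]) := by
    rintro n hn g ⟨hg, hgu⟩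
    have hNn : N ≤ cnt n := hcn₀ ▸ hcnt hn
    by_cases hact : activeAt st n
    · have hc : cnt (n + 1) = cnt n + 1 := by simp [cnt, Nat.count_succ, hact]
      obtain ⟨hrel, hle⟩ := hu (cnt n) hNn
      have hp1 := playBranch_count hst n
      have hp2 := playBranch_count hst (n + 1)
      change playBranch st (cnt n) = _ at hp1
      change playBranch st (cnt (n + 1)) = _ at hp2
      rw [← hc, hp1, hp2, huk _ hNn, huk (cnt (n + 1)) (by omega), ← hgu] at hrel
      obtain ⟨g', hg', h1, h2, h3⟩ := hact.2.word g hg y _ _ hrel (hval _ (by omega)).2 hle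
      refine ⟨g', ⟨hg', h1⟩, ?_, fun _ => h3⟩
      have hcases : b (cnt n) = 0 ∨ b (cnt n) = 1 := by
        revert hle
        generalize b (cnt n) = v
        clear * -
        revert v
        decide
      rcases hcases with h | h
      · exact Or.inl (h2 h)
      · exact Or.inr (Or.inl (h3 h))
    · have hc : cnt (n + 1) = cnt n := by simp [cnt, Nat.count_succ, hact]
      have hs : SilentStep (st n).seq (st (n + 1)).seq (r n) := (hst n).resolve_right hact |>.1
      obtain ⟨g', hg', h1, h2⟩ := hs.word g hg
      exact ⟨g', ⟨hg', by rw [hc, h1, hgu]⟩, h2 y, fun h => absurd h hact⟩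
  obtain ⟨g₀, hg₀⟩ := hstart
  have : Nonempty (AForm P V) := ⟨g₀⟩
  choose! next hnext₁ hnext₂ hnext₃ using hstep
  let G : ℕ → AForm P V := fun k => Nat.rec g₀ (fun k g => next (n₀ + k) g) k
  have hG : ∀ k, Tr (n₀ + k) (G k) := by
    intro k
    induction k with
    | zero => exact hg₀
    | succ k ih => exact hnext₁ (n₀ + k) (by omega) _ ih
  obtain ⟨a, K, A, h1, h2⟩ := exists_stable_letter (fun k => (st (n₀ + k)).seq.ctrl)
    (fun k => (G k).2 y) (fun k a => (r (n₀ + k)).IsReset a)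
    (fun k => (st (n₀ + k)).seq.nodup) (fun k => (st (n₀ + k)).seq.sublist _ (hG k).1 y)
    (numValues Q + 1) (fun k => (st (n₀ + k)).length_ctrl_le)
    (by
      intro k
      rcases hst (n₀ + k) with h | h
      · obtain ⟨a, -, ha, hsub⟩ := exists_fresh_sublist h.1.ctrl
        exact ⟨a, ha, hsub⟩
      · obtain ⟨a, -, ha, hsub⟩ := h.2.ctrl
        exact ⟨a, ha, hsub⟩)
    (fun k => hnext₂ (n₀ + k) (by omega) _ (hG k))
    (by
      intro K
      -- Progress at position `m` of the branch is made at the active move number `m` of the play,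
      -- where a fresh letter is appended.
      obtain ⟨m, hm, -, hbm⟩ := hb (cnt (n₀ + K))
      obtain ⟨n, hact, hcn⟩ : ∃ n, activeAt st n ∧ cnt n = m :=
        ⟨_, Nat.nth_mem_of_infinite hinf m, Nat.count_nth_of_infinite hinf m⟩
      have hle : n₀ + K ≤ n := by
        by_contra! hlt
        have h1 : cnt (n + 1) ≤ cnt (n₀ + K) := hcnt hlt
        have h2 : cnt (n + 1) = cnt n + 1 := by simp [cnt, Nat.count_succ, hact]
        omega
      obtain ⟨k, rfl⟩ : ∃ k, n = n₀ + k := ⟨n - n₀, by omega⟩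
      exact ⟨k, by omega, hnext₃ (n₀ + k) (by omega) _ (hG k) hact (by rw [hcn, hbm])⟩)
  refine ⟨a, n₀ + K, A, fun n hn => ?_, fun M => ?_⟩
  · obtain ⟨k, rfl⟩ : ∃ k, n = n₀ + k := ⟨n - n₀, by omega⟩
    exact h1 k (by omega)
  · obtain ⟨k, hk, h3⟩ := h2 M
    exact ⟨n₀ + k, by omega, h3⟩

/-- Every infinite play contains a repeat with an invariant. -/
theorem exists_good_repeat (hQ : Q ∈ (Kmu P V).proofs) {st : ℕ → PlayState Q}
    {r : ℕ → RRule P V} (hst : ∀ n, PlayStep (st n) (r n) (st (n + 1)))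
    (h0 : (st 0).node = []) :
    ∃ i j, i < j ∧ (st j).seq = (st i).seq ∧ ∃ a, (∀ n, i ≤ n → n ≤ j →
      a ∈ (st n).seq.ctrl ∧ (st n).seq.ctrl.takeWhile (fun b => b ≠ a) =
        (st j).seq.ctrl.takeWhile (fun b => b ≠ a)) ∧
      ∃ n, i ≤ n ∧ n < j ∧ (r n).IsReset a := by
  obtain ⟨a, N, A, h1, h2⟩ := exists_stable_letter_of_play hQ hst h0
  have : Finite (Set.range fun s : PlayState Q => s.seq) := PlayState.finite_seqs Q
  obtain ⟨L, hL⟩ := Finite.exists_infinite_fiber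
    (fun n => (⟨(st n).seq, st n, rfl⟩ : Set.range fun s : PlayState Q => s.seq))
  have hL' := Set.infinite_coe_iff.1 hL
  -- In an infinite class of times with equal sequents, choose `i` after stabilization, then a reset
  -- of `a` at or after `i`, then `j` in the class after that reset.
  obtain ⟨i, hi, hNi⟩ := hL'.exists_gt N
  obtain ⟨n, hin, hn⟩ := h2 i
  obtain ⟨j, hj, hnj⟩ := hL'.exists_gt n
  have hi' : (st i).seq = L.1 := congrArg Subtype.val hi
  have hj' : (st j).seq = L.1 := congrArg Subtype.val hj
  refine ⟨i, j, by omega, hj'.trans hi'.symm, a, fun m him hmj => ?_, n, hin, hnj, hn⟩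
  exact ⟨(h1 m (by omega)).1, ((h1 m (by omega)).2).trans ((h1 j (by omega)).2).symm⟩

/-- Completeness of the reset system with respect to `K_μ`. -/
theorem proves_unannotated {Γ : KSeq P V} (h : (Kmu P V).Proves Γ) :
    (RKmuF P V).Proves Γ.unannotated := by
  classical
  obtain ⟨Q, hQ, rfl⟩ := h
  choose rule hconc hprem using exists_play (Q := Q) hQ.1
  choose! next hnext hplay using hprem
  let s₀ : PlayState Q := ⟨KSeq.unannotated (Q.label []), [], Q.root_mem, by
    change Prod.fst '' ((fun φ => (φ, fun _ => [])) '' (Q.label []).forms) = _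
    rw [Set.image_image]
    simp, fun a ha => absurd ha List.not_mem_nil⟩
  refine proves_of_strategy (fun s : PlayState Q => s.seq) rule next s₀ hconc
    (fun s i hi => hnext s i hi) ?_
  intro st d hst0 hst
  refine exists_good_repeat hQ (r := fun n => rule (st n)) (fun n => ?_) (by rw [hst0])
  rw [(hst n).2]
  exact hplay _ _ (hst n).1

end Plays

end CyclicMu

theorem mainTheorem10 {P V : Type*} (Γ : CyclicMu.KSeq P V)
    (h : (CyclicMu.Kmu P V).Proves Γ) :
    (CyclicMu.RKmuF P V).Proves Γ.unannotated :=
  CyclicMu.proves_unannotated h
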